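/- Let $\mathcal R>0$, let $\kappa:[0,1]\to[0,1]$ be measurable with $\kappa\ge\nu$ for some $\nu>0$, and let $(\mathcal P_a)_{a\in[0,1]}$ be a measurable family of probability densities on $\mathbb R$. Put $j_a(v)=\mathcal R\,\kappa(a)\,\mathcal P_a(v)$ and assume: (III) $j_a(v)=j_a(-v)$ for all $a\in[0,1]$, $v\in\mathbb R$; (i) there are $\mathcal C$ and $\eta>0$ such that $\mathcal P_a(v)\le \mathcal C\,e^{-\eta(|v|-|w|)}\,\mathcal P_a(w)$ for all $a\in[0,1]$ and all $v,w\in\mathbb R$ with $|v|\ge|w|$; (ii) every $\mathcal P_a$ is differentiable, and there is $\mu$ such that $\sup_{|w-v|\le 1}\big|\frac{d\mathcal P_a}{dv}(w)\big|\le \mu\,(1+|v|)\,\mathcal P_a(v)$ for all $a\in[0,1]$, $v\in\mathbb R$. Let $X_1,X_2,\dots$ be i.i.d. random variables with density $\tilde P(v)=\int_0^1 \frac{\kappa(a)}{\bar\kappa}\,\mathcal P_a(v)\,da$, $\bar\kappa=\int_0^1\kappa(a)\,da$, and let $Y_n=\sum_{m=1}^n X_m$. For $L\ge 0$ let $\pi_L$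 be the joint law of the overshoot over $L$ and of the crossing jump, i.e. the measure on $\mathbb R^+\times\mathbb R^+$ given by $$\pi_L(A)=\sum_{n=1}^\infty \Pr\big[(Y_n-L,\,X_n)\in A,\ Y_n\ge L,\ Y_r<L \text{ for } 1\le r<n\big],$$ and put $D=\pi_0$, the joint law of the record increment and of the jump that makes the record. Then $m=\iint x\,D(dx,dy)$ satisfies $0<m<\infty$, and there is a measurable function $$\pi_\infty(v,w)=\frac1m\int_{x\in(v,\infty)} D(dx,w)$$ (meaning: for each $v\ge 0$, $\pi_\infty(v,\cdot)$ is the density in $w$ of the measure $B\mapsto D((v,\infty)\times B)/m$) such that, with $\|\cdot\|_1$ the $L^1$ norm on $\mathbb R^+\times\mathbb R^+$ (for differences of measures: the total variation norm, i.e. the $L^1$ norm of the difference of the densities with respect to a common dominating measure): (1) $\|\pi_L-\pi_\infty\|_1\to 0$ as $L\to\infty$; (2) there are $C,c>0$ with $\|\pi_L-\pi_\infty\|_1\le C e^{-cL}$ for all $L\ge 0$; (3) $L\mapsto\|\pi_L-\pi_\infty\|_1$ is non-increasing on $[0,\infty)$. -/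

import Mathlib

open MeasureTheory ProbabilityTheory Filter Topology Set
open scoped ENNReal

noncomputable section

/-- The rate `j_a(v) = R κ(a) P_a(v)` of momentum jumps of size `v` at the position `a`. -/
def jumpRate (R : ℝ) (κ : unitInterval → ℝ) (P : unitInterval → ℝ → ℝ)
    (a : unitInterval) (v : ℝ) : ℝ :=
  R * κ a * P a v

/-- The kick distributions: a measurable family `P_a`, `a ∈ [0,1]`, of probability densities. -/
structure IsKickFamily (P : unitInterval → ℝ → ℝ) : Prop where
  measurable : Measurable (Function.uncurry P)
  nonneg : ∀ a v, 0 ≤ P a v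
  integral_eq_one : ∀ a, ∫ v, P a v = 1

/-- The coin probabilities: measurable, at most `1`, and bounded below by some `ν > 0`. -/
structure IsCoin (κ : unitInterval → ℝ) : Prop where
  measurable : Measurable κ
  lower : ∃ ν : ℝ, 0 < ν ∧ ∀ a, ν ≤ κ a
  le_one : ∀ a, κ a ≤ 1

/-- Symmetry of the jump rates. -/
def SymmetricRates (j : unitInterval → ℝ → ℝ) : Prop :=
  ∀ a v, j a v = j a (-v)

/-- Exponential tails, uniformly in the position. -/
def ExponentialTails (P : unitInterval → ℝ → ℝ) : Prop :=
  ∃ C η : ℝ, 0 < η ∧ ∀ (a : unitInterval) (v w : ℝ), |w| ≤ |v| →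
    P a v ≤ C * Real.exp (-η * (|v| - |w|)) * P a w

/-- The derivative bound
`sup_v P_a(v)⁻¹ (1 + |v|)⁻¹ sup_{|w - v| ≤ 1} |P_a'(w)| ≤ μ`, uniformly in the position,
with the denominators multiplied out. -/
def DerivativeBound (P : unitInterval → ℝ → ℝ) : Prop :=
  (∀ a, Differentiable ℝ (P a)) ∧
  ∃ μ : ℝ, ∀ (a : unitInterval) (v w : ℝ), |w - v| ≤ 1 →
    |deriv (P a) w| ≤ μ * (1 + |v|) * P a v

/-- The averaged jump density `∫₀¹ (κ(a) / κ̄) P_a(v) da`, where `κ̄ = ∫₀¹ κ(a) da`. -/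
def averagedDensity (κ : unitInterval → ℝ) (P : unitInterval → ℝ → ℝ) (v : ℝ) : ℝ :=
  ∫ a, κ a / (∫ x, κ x) * P a v

/-- `X` is a sequence of independent random variables, each with density `p`. -/
structure IsIIDWithDensity {Ω : Type*} [MeasurableSpace Ω] (Pr : Measure Ω)
    (X : ℕ → Ω → ℝ) (p : ℝ → ℝ) : Prop where
  measurable : ∀ n, Measurable (X n)
  indep : iIndepFun X Pr
  law : ∀ n, Pr.map (X n) = volume.withDensity (fun v => ENNReal.ofReal (p v))

/-- The random walk `Y_n`, the sum of the first `n` jumps. The jumps are numbered from `0`, so that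
`X n` is the jump from `Y_n` to `Y_{n+1}`. -/
def walk {Ω : Type*} (X : ℕ → Ω → ℝ) (n : ℕ) (ω : Ω) : ℝ :=
  ∑ m ∈ Finset.range n, X m ω

/-- The event that the walk, after its start, is first at or above the level `L` at time `n + 1`. -/
def crossingEvent {Ω : Type*} (X : ℕ → Ω → ℝ) (L : ℝ) (n : ℕ) : Set Ω :=
  {ω | L ≤ walk X (n + 1) ω ∧ ∀ r, 1 ≤ r → r ≤ n → walk X r ω < L}

/-- The law `π_L` of the pair (overshoot over `L`, crossing jump), summed over the time of the
crossing. -/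
def crossingLaw {Ω : Type*} [MeasurableSpace Ω] (Pr : Measure Ω) (X : ℕ → Ω → ℝ) (L : ℝ) :
    Measure (ℝ × ℝ) :=
  Measure.sum fun n : ℕ =>
    (Pr.restrict (crossingEvent X L n)).map fun ω => (walk X (n + 1) ω - L, X n ω)

/-- The law `D` of the first record increment, together with the jump that makes the record. -/
def recordLaw {Ω : Type*} [MeasurableSpace Ω] (Pr : Measure Ω) (X : ℕ → Ω → ℝ) :
    Measure (ℝ × ℝ) :=
  crossingLaw Pr X 0

/-- The mean `∬ x D(dx, dy)` of the first coordinate (over `x > 0`). -/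
def meanIncrement (D : Measure (ℝ × ℝ)) : ℝ≥0∞ :=
  ∫⁻ z, ENNReal.ofReal z.1 ∂D

/-- `q(v, w) = (∫_v^∞ D(dx, w)) / ∬ x D(dx, dy)`: for every `v ≥ 0`, the function `q(v, ·)` is the
density in `w` of the measure `B ↦ D((v, ∞) × B)`, divided by the mean increment. -/
def IsLimitDensity (D : Measure (ℝ × ℝ)) (q : ℝ → ℝ → ℝ≥0∞) : Prop :=
  Measurable (Function.uncurry q) ∧
  ∀ v : ℝ, 0 ≤ v → ∀ B : Set ℝ, MeasurableSet B →
    ∫⁻ w in B, q v w = D (Ioi v ×ˢ B) / meanIncrement D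

/-- The measure on `ℝ⁺ × ℝ⁺` with density `q`. -/
def quadrantLaw (q : ℝ → ℝ → ℝ≥0∞) : Measure (ℝ × ℝ) :=
  ((volume : Measure (ℝ × ℝ)).restrict (Ioi 0 ×ˢ Ioi 0)).withDensity (Function.uncurry q)

/-- The `L¹` distance of two finite measures: the `L¹` norm of the difference of their densities
with respect to a common dominating measure, i.e. the total variation norm of the difference. -/
def l1Dist {E : Type*} [MeasurableSpace E] (ρ σ : Measure E) : ℝ≥0∞ :=
  ∫⁻ z, ENNReal.ofReal |(ρ.rnDeriv (ρ + σ) z).toReal - (σ.rnDeriv (ρ + σ) z).toReal| ∂(ρ + σ)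

end

/-!
The proof treats the pair (overshoot, crossing jump) as a Markov process whose time is the level.

When the level rises from `t` to `t + s`, a walk that has just crossed `t` with overshoot `v` either
has already crossed `t + s` (if `s ≤ v`, leaving overshoot `v - s` and the same jump), or restarts
afresh and has to cross the level `s - v`. The corresponding transition operator is `advance`, and
`lintegral_crossingLaw_add` says that the crossing laws form one of its orbits, started at the
record law `D`. This is proved with `crossOp`, which computes crossing laws by conditioning on the
first jump. All levels are crossed almost surely (`measure_exists_walk_ge`), by Kolmogorov's zero-one law
and the symmetry of the jumps, so that the operators are Markov.

The limit law is the usual stationary law of the residual life: a record increment is chosen with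
probability proportional to its size, and the overshoot is uniform inside it. It is invariant
(`lintegral_advance_quadrantLaw`) because the trajectory of `advance` inside one record increment
and the renewal equation for `D` are two ways to cut the same interval (`setLIntegral_advance_add`).
Since a Markov operator does not increase the `L¹` distance, the distance to the limit law is
non-increasing.

For the exponential rate, the tail hypothesis says that, from wherever a level is crossed, the
overshoot has an exponential moment bounded independently of the level
(`lintegral_overshootWeight_le`). This is a Lyapunov condition for the weight `exp (η |v| / 2)`. The
jump density is bounded below on bounded sets, so crossing with two jumps gives the crossing laws of
all levels in a bounded interval a common component (`exists_le_crossingLaw`). The two conditions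
together make `advance` a strict contraction for a weighted oscillation seminorm
(`exists_contraction`, in the manner of Harris' theorem), and duality turns this into a geometric
bound for the `L¹` distance along a sequence of levels; monotonicity fills the gaps.
-/

/-! ### Crossings through first-step analysis -/

/-- The law of a single jump with density `p`. -/
noncomputable abbrev stepLaw (p : ℝ → ℝ) : Measure ℝ :=
  volume.withDensity fun v => ENNReal.ofReal (p v)

/-- `crossOp μ n f t` is the integral of `f (overshoot, crossing jump)` over the event that a walk
with step law `μ` first reaches the level `t` with its jump number `n`, computed by conditioning on
the first jump. -/
noncomputable def crossOp (μ : Measure ℝ) : ℕ → (ℝ × ℝ → ℝ≥0∞) → ℝ → ℝ≥0∞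
  | 0, f, t => ∫⁻ x, (if t ≤ x then f (x - t, x) else 0) ∂μ
  | n + 1, f, t => ∫⁻ x, (if x < t then crossOp μ n f (t - x) else 0) ∂μ

lemma measurable_crossOp (μ : Measure ℝ) [SFinite μ] (n : ℕ) {f : ℝ × ℝ → ℝ≥0∞}
    (hf : Measurable f) : Measurable (crossOp μ n f) := by
  induction n with
  | zero =>
    refine Measurable.lintegral_prod_right'
      (f := fun z : ℝ × ℝ => if z.1 ≤ z.2 then f (z.2 - z.1, z.2) else 0) ?_
    exact Measurable.ite (measurableSet_le measurable_fst measurable_snd) (by fun_prop)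
      measurable_const
  | succ n ih =>
    refine Measurable.lintegral_prod_right'
      (f := fun z : ℝ × ℝ => if z.2 < z.1 then crossOp μ n f (z.1 - z.2) else 0) ?_
    exact Measurable.ite (measurableSet_lt measurable_snd measurable_fst) (by fun_prop)
      measurable_const

/-- A bound on the first-step integrals at nonnegative levels passes to all crossing times. -/
lemma crossOp_le_mul (μ : Measure ℝ) {f g : ℝ × ℝ → ℝ≥0∞} {K : ℝ≥0∞} (hK : K ≠ ∞)
    (h : ∀ t, 0 ≤ t → crossOp μ 0 f t ≤ K * crossOp μ 0 g t) (n : ℕ) :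
    ∀ t, 0 ≤ t → crossOp μ n f t ≤ K * crossOp μ n g t := by
  induction n with
  | zero => exact h
  | succ n ih =>
    intro t ht
    simp only [crossOp]
    rw [← lintegral_const_mul' _ _ hK]
    refine lintegral_mono fun x => ?_
    split_ifs with hx
    · exact ih _ (by linarith)
    · simp

/-- Decomposition of the crossing of `t + s` according to the crossing of `t`: either the same jump
crosses both levels, or the walk restarts after crossing `t` and crosses the remaining level. -/
lemma crossOp_add (μ : Measure ℝ) [SFinite μ] {f : ℝ × ℝ → ℝ≥0∞} (hf : Measurable f) {s : ℝ}
    (hs : 0 ≤ s) (N : ℕ) : ∀ t, crossOp μ N f (t + s) =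
      crossOp μ N (fun z => if s ≤ z.1 then f (z.1 - s, z.2) else 0) t +
      ∑ n ∈ Finset.range N,
        crossOp μ n (fun z => if s ≤ z.1 then 0 else crossOp μ (N - 1 - n) f (s - z.1)) t := by
  induction N with
  | zero =>
    intro t
    simp only [crossOp, Finset.range_zero, Finset.sum_empty, add_zero]
    refine lintegral_congr fun x => ?_
    by_cases h1 : t + s ≤ x
    · rw [if_pos h1, if_pos (by linarith), if_pos (by linarith), sub_sub]
    · rw [if_neg h1]
      split_ifs with h2 h3
      · exact absurd (by linarith) h1
      · rfl
      · rfl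
  | succ N ih =>
    intro t
    simp only [Nat.sub_sub, Nat.add_comm 1] at ih
    have hm0 : ∀ k, Measurable fun z : ℝ × ℝ =>
        if s ≤ z.1 then (0 : ℝ≥0∞) else crossOp μ k f (s - z.1) := fun k =>
      Measurable.ite (measurableSet_le measurable_const measurable_fst) measurable_const
        ((measurable_crossOp μ k hf).comp (by fun_prop))
    have hm1 : Measurable fun z : ℝ × ℝ => if s ≤ z.1 then f (z.1 - s, z.2) else 0 :=
      Measurable.ite (measurableSet_le measurable_const measurable_fst) (by fun_prop)
        measurable_const
    have hms : ∀ (n : ℕ) (g : ℝ × ℝ → ℝ≥0∞), Measurable g →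
        Measurable fun x => if x < t then crossOp μ n g (t - x) else 0 := fun n g hg =>
      Measurable.ite (measurableSet_lt measurable_id measurable_const)
        ((measurable_crossOp μ n hg).comp (by fun_prop)) measurable_const
    rw [Finset.sum_range_succ']
    simp only [crossOp, Nat.add_sub_cancel, Nat.sub_zero]
    rw [← lintegral_finsetSum _ (fun n _ => hms n _ (hm0 _)), ← add_assoc,
      ← lintegral_add_left (hms N _ hm1), ← lintegral_add_left]
    · refine lintegral_congr fun x => ?_
      by_cases h1 : x < t
      · rw [if_pos (show x < t + s by linarith), if_neg (not_le.2 h1), add_zero,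
          show t + s - x = t - x + s by ring, ih (t - x)]
        simp only [if_pos h1]
      · simp only [if_neg h1, Finset.sum_const_zero, zero_add, if_pos (not_lt.1 h1)]
        by_cases h2 : x < t + s
        · rw [if_pos h2, if_neg (by linarith), show s - (x - t) = t + s - x by ring]
        · rw [if_neg h2, if_pos (by linarith)]
    · exact (hms N _ hm1).add (Finset.measurable_fun_sum _ fun n _ => hms n _ (hm0 _))

section Walk

variable {Ω : Type*} [MeasurableSpace Ω] {Pr : Measure Ω} {X : ℕ → Ω → ℝ} {p : ℝ → ℝ}

lemma IsIIDWithDensity.shift (hX : IsIIDWithDensity Pr X p) :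
    IsIIDWithDensity Pr (fun n => X (n + 1)) p :=
  ⟨fun n => hX.measurable (n + 1), hX.indep.precomp (add_left_injective 1),
    fun n => hX.law (n + 1)⟩

lemma IsIIDWithDensity.indepFun_shift (hX : IsIIDWithDensity Pr X p) :
    IndepFun (X 0) (fun ω n => X (n + 1) ω) Pr := by
  have h := indep_iSup_of_disjoint (fun n => (hX.measurable n).comap_le) hX.indep
    (S := {0}) (T := {n | 1 ≤ n}) (by simp)
  rw [IndepFun_iff_Indep]
  refine indep_of_indep_of_le_left (indep_of_indep_of_le_right h ?_) ?_
  · rw [MeasurableSpace.pi, MeasurableSpace.comap_iSup]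
    refine iSup_le fun n => ?_
    rw [MeasurableSpace.comap_comp]
    exact le_iSup₂_of_le (n + 1) (by simp) le_rfl
  · exact le_iSup₂_of_le 0 (by simp) le_rfl

lemma isProbabilityMeasure_stepLaw [IsProbabilityMeasure Pr] (hX : IsIIDWithDensity Pr X p) :
    IsProbabilityMeasure (stepLaw p) := by
  rw [stepLaw, ← hX.law 0]
  exact Measure.isProbabilityMeasure_map (hX.measurable 0).aemeasurable

lemma measurable_walk (hX : ∀ n, Measurable (X n)) (n : ℕ) : Measurable (walk X n) :=
  Finset.measurable_fun_sum _ fun m _ => hX m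

lemma walk_succ' {Ω : Type*} {X : ℕ → Ω → ℝ} (n : ℕ) (ω : Ω) :
    walk X (n + 1) ω = X 0 ω + walk (fun n => X (n + 1)) n ω := by
  simp only [walk, Finset.sum_range_succ']
  ring

lemma measurableSet_crossingEvent (hX : ∀ n, Measurable (X n)) (L : ℝ) (n : ℕ) :
    MeasurableSet (crossingEvent X L n) := by
  have : crossingEvent X L n = {ω | L ≤ walk X (n + 1) ω} ∩
      ⋂ r : ℕ, ⋂ (_ : 1 ≤ r), ⋂ (_ : r ≤ n), {ω | walk X r ω < L} := by
    ext ω; simp [crossingEvent]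
  rw [this]
  refine (measurableSet_le measurable_const (measurable_walk hX _)).inter ?_
  exact MeasurableSet.iInter fun r => MeasurableSet.iInter fun _ => MeasurableSet.iInter fun _ =>
    measurableSet_lt (measurable_walk hX _) measurable_const

lemma mem_crossingEvent_succ {Ω : Type*} {X : ℕ → Ω → ℝ} (L : ℝ) (n : ℕ) (ω : Ω) :
    ω ∈ crossingEvent X L (n + 1) ↔
    X 0 ω < L ∧ ω ∈ crossingEvent (fun n => X (n + 1)) (L - X 0 ω) n := by
  simp only [crossingEvent, mem_ofPred_eq]
  rw [walk_succ' (n + 1)]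
  constructor
  · rintro ⟨h1, h2⟩
    refine ⟨by simpa [walk] using h2 1 le_rfl (by omega), by linarith, fun r h3 h4 => ?_⟩
    have := h2 (r + 1) (by omega) (by omega)
    rw [walk_succ'] at this
    linarith
  · rintro ⟨h0, h1, h2⟩
    refine ⟨by linarith, fun r h3 h4 => ?_⟩
    obtain ⟨r, rfl⟩ : ∃ k, r = k + 1 := ⟨r - 1, by omega⟩
    rw [walk_succ']
    rcases Nat.eq_zero_or_pos r with rfl | hr
    · simpa [walk] using h0
    · have := h2 r hr (by omega)
      linarith

lemma setLIntegral_crossingEvent [IsProbabilityMeasure Pr] {f : ℝ × ℝ → ℝ≥0∞} (hf : Measurable f)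
    (n : ℕ) : ∀ {X : ℕ → Ω → ℝ}, IsIIDWithDensity Pr X p → ∀ L,
      ∫⁻ ω in crossingEvent X L n, f (walk X (n + 1) ω - L, X n ω) ∂Pr =
        crossOp (stepLaw p) n f L := by
  induction n with
  | zero =>
    intro X hX L
    rw [← lintegral_indicator (measurableSet_crossingEvent hX.measurable L 0)]
    simp only [crossOp]
    rw [stepLaw, ← hX.law 0, lintegral_map _ (hX.measurable 0)]
    · refine lintegral_congr fun ω => ?_
      have h0 : ω ∈ crossingEvent X L 0 ↔ L ≤ X 0 ω := by
        simp only [crossingEvent, mem_ofPred_eq, walk, zero_add, Finset.range_one,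
          Finset.sum_singleton, and_iff_left_iff_imp]
        intro _ r h1 h2
        omega
      by_cases h : L ≤ X 0 ω
      · rw [indicator_of_mem (h0.2 h), if_pos h]; simp [walk]
      · rw [indicator_of_notMem (fun h' => h (h0.1 h')), if_neg h]
    · exact Measurable.ite (measurableSet_le measurable_const measurable_id) (by fun_prop)
        measurable_const
  | succ n ih =>
    intro X hX L
    -- the walk after the first jump is expressed through the coordinate process on sequences
    let Z : ℕ → (ℕ → ℝ) → ℝ := fun k u => u k
    have hZ : ∀ k, Measurable (Z k) := fun k => measurable_pi_apply k
    let S : Set (ℝ × (ℕ → ℝ)) := {z | z.2 ∈ crossingEvent Z z.1 n}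
    have hS : MeasurableSet S := by
      have : S = {z | z.1 ≤ walk Z (n + 1) z.2} ∩
          ⋂ r : ℕ, ⋂ (_ : 1 ≤ r), ⋂ (_ : r ≤ n), {z | walk Z r z.2 < z.1} := by
        ext z; simp [S, crossingEvent]
      rw [this]
      refine (measurableSet_le measurable_fst
        ((measurable_walk hZ _).comp measurable_snd)).inter ?_
      exact MeasurableSet.iInter fun r => MeasurableSet.iInter fun _ =>
        MeasurableSet.iInter fun _ =>
          measurableSet_lt ((measurable_walk hZ _).comp measurable_snd) measurable_fst
    let G : ℝ × (ℕ → ℝ) → ℝ≥0∞ := S.indicator fun z => f (walk Z (n + 1) z.2 - z.1, Z n z.2)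
    have hG : Measurable G := by
      refine Measurable.indicator (hf.comp ?_) hS
      exact (((measurable_walk hZ _).comp measurable_snd).sub measurable_fst).prodMk
        ((hZ n).comp measurable_snd)
    let T : Ω → ℕ → ℝ := fun ω k => X (k + 1) ω
    have hT : Measurable T := measurable_pi_lambda _ fun k => hX.measurable (k + 1)
    have hpair := (indepFun_iff_map_prod_eq_prod_map_map (hX.measurable 0).aemeasurable
      hT.aemeasurable).1 hX.indepFun_shift
    let H : ℝ × (ℕ → ℝ) → ℝ≥0∞ := fun z => if z.1 < L then G (L - z.1, z.2) else 0
    have hH : Measurable H :=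
      Measurable.ite (measurableSet_lt measurable_fst measurable_const) (by fun_prop)
        measurable_const
    have h1 : ∫⁻ ω in crossingEvent X L (n + 1), f (walk X (n + 1 + 1) ω - L, X (n + 1) ω) ∂Pr
        = ∫⁻ ω, H (X 0 ω, T ω) ∂Pr := by
      rw [← lintegral_indicator (measurableSet_crossingEvent hX.measurable L (n + 1))]
      refine lintegral_congr fun ω => ?_
      have hmem := mem_crossingEvent_succ (X := X) L n ω
      simp only [H, G]
      by_cases h0 : X 0 ω < L
      · rw [if_pos h0]
        by_cases h2 : ω ∈ crossingEvent (fun n => X (n + 1)) (L - X 0 ω) n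
        · rw [indicator_of_mem (hmem.2 ⟨h0, h2⟩),
            indicator_of_mem (show (L - X 0 ω, T ω) ∈ S from h2),
            walk_succ']
          congr 2
          change _ = walk (fun n => X (n + 1)) (n + 1) ω - (L - X 0 ω)
          ring
        · rw [indicator_of_notMem (fun h => h2 (hmem.1 h).2),
            indicator_of_notMem (show (L - X 0 ω, T ω) ∉ S from h2)]
      · rw [if_neg h0, indicator_of_notMem (fun h => h0 (hmem.1 h).1)]
    rw [h1, ← lintegral_map hH ((hX.measurable 0).prodMk hT), hpair,
      lintegral_prod _ hH.aemeasurable, hX.law 0]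
    simp only [crossOp]
    refine lintegral_congr fun x => ?_
    by_cases hx : x < L
    · simp only [H, if_pos hx]
      rw [lintegral_map (by fun_prop) hT, ← ih hX.shift (L - x),
        ← lintegral_indicator (measurableSet_crossingEvent hX.shift.measurable _ n)]
      rfl
    · simp [H, if_neg hx]

/-- The crossing law depends on the jumps only through their density. -/
theorem lintegral_crossingLaw [IsProbabilityMeasure Pr] (hX : IsIIDWithDensity Pr X p)
    {f : ℝ × ℝ → ℝ≥0∞} (hf : Measurable f) (L : ℝ) :
    ∫⁻ z, f z ∂crossingLaw Pr X L = ∑' n, crossOp (stepLaw p) n f L := by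
  rw [crossingLaw, lintegral_sum_measure]
  congr 1
  ext n
  rw [lintegral_map hf, setLIntegral_crossingEvent hf n hX]
  exact ((measurable_walk hX.measurable _).sub_const L).prodMk (hX.measurable n)

/-! ### The overshoot process as a Markov process in the level -/

/-- The transition operator of the pair (overshoot, crossing jump) when the level rises by `s`:
an overshoot of at least `s` shrinks by `s`, and otherwise the walk restarts and crosses the
remaining level. -/
noncomputable def advance (Pr : Measure Ω) (X : ℕ → Ω → ℝ) (s : ℝ) (f : ℝ × ℝ → ℝ≥0∞)
    (z : ℝ × ℝ) : ℝ≥0∞ :=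
  if s ≤ z.1 then f (z.1 - s, z.2) else ∫⁻ y, f y ∂crossingLaw Pr X (s - z.1)

lemma measurable_lintegral_crossingLaw [IsProbabilityMeasure Pr] (hX : IsIIDWithDensity Pr X p)
    {f : ℝ × ℝ → ℝ≥0∞} (hf : Measurable f) :
    Measurable fun t => ∫⁻ y, f y ∂crossingLaw Pr X t := by
  have := isProbabilityMeasure_stepLaw hX
  simp only [lintegral_crossingLaw hX hf]
  exact Measurable.tsum fun n => measurable_crossOp _ n hf

/-- Joint measurability of the transition operator in the level and the state. -/
lemma measurable_advance_uncurry [IsProbabilityMeasure Pr] (hX : IsIIDWithDensity Pr X p)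
    {f : ℝ × ℝ → ℝ≥0∞} (hf : Measurable f) :
    Measurable fun y : ℝ × ℝ × ℝ => advance Pr X y.1 f y.2 :=
  Measurable.ite (measurableSet_le measurable_fst (by fun_prop)) (by fun_prop)
    ((measurable_lintegral_crossingLaw hX hf).comp (by fun_prop))

lemma measurable_advance [IsProbabilityMeasure Pr] (hX : IsIIDWithDensity Pr X p)
    {f : ℝ × ℝ → ℝ≥0∞} (hf : Measurable f) (s : ℝ) : Measurable (advance Pr X s f) :=
  (measurable_advance_uncurry hX hf).comp measurable_prodMk_left

/-- Summation over pairs `(n, k)` along the lines `n + k + 1 = N`. -/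
lemma tsum_sum_range_sub (b : ℕ → ℕ → ℝ≥0∞) :
    ∑' N, ∑ n ∈ Finset.range N, b n (N - 1 - n) = ∑' n, ∑' k, b n k := by
  have hE : ∀ N, ∑ n ∈ Finset.range N, b n (N - 1 - n) =
      ∑' n, if n < N then b n (N - 1 - n) else 0 := by
    intro N
    rw [tsum_eq_sum (s := Finset.range N) (fun n hn => if_neg (by simpa using hn))]
    exact Finset.sum_congr rfl fun n hn => (if_pos (Finset.mem_range.1 hn)).symm
  rw [tsum_congr hE, ENNReal.tsum_comm]
  refine tsum_congr fun n => ?_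
  have h : ∑ N ∈ Finset.range (n + 1), (if n < N then b n (N - 1 - n) else 0) +
      ∑' k, (if n < k + (n + 1) then b n (k + (n + 1) - 1 - n) else 0) =
      ∑' N, if n < N then b n (N - 1 - n) else 0 :=
    Summable.sum_add_tsum_nat_add' (f := fun N => if n < N then b n (N - 1 - n) else 0)
      ENNReal.summable
  rw [← h, Finset.sum_eq_zero, zero_add]
  · refine tsum_congr fun k => ?_
    rw [if_pos (by omega), show k + (n + 1) - 1 - n = k by omega]
  · exact fun N hN => if_neg (not_lt.2 (Nat.lt_succ_iff.1 (Finset.mem_range.1 hN)))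

/-- The crossing laws form an orbit of the transition operators. -/
theorem lintegral_crossingLaw_add [IsProbabilityMeasure Pr] (hX : IsIIDWithDensity Pr X p)
    {f : ℝ × ℝ → ℝ≥0∞} (hf : Measurable f) {s : ℝ} (hs : 0 ≤ s) (t : ℝ) :
    ∫⁻ z, f z ∂crossingLaw Pr X (t + s) = ∫⁻ z, advance Pr X s f z ∂crossingLaw Pr X t := by
  have := isProbabilityMeasure_stepLaw hX
  let F : ℝ × ℝ → ℝ≥0∞ := fun z => if s ≤ z.1 then f (z.1 - s, z.2) else 0
  let G : ℕ → ℝ × ℝ → ℝ≥0∞ := fun k z => if s ≤ z.1 then 0 else crossOp (stepLaw p) k f (s - z.1)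
  have hF : Measurable F :=
    Measurable.ite (measurableSet_le measurable_const measurable_fst) (by fun_prop)
      measurable_const
  have hG : ∀ k, Measurable (G k) := fun k =>
    Measurable.ite (measurableSet_le measurable_const measurable_fst) measurable_const
      ((measurable_crossOp (stepLaw p) k hf).comp (by fun_prop))
  have hadv : ∀ z, advance Pr X s f z = F z + ∑' k, G k z := by
    intro z
    simp only [advance, F, G]
    split_ifs with h
    · simp
    · rw [lintegral_crossingLaw hX hf, zero_add]
  simp only [hadv]
  rw [lintegral_add_left hF, lintegral_tsum fun k => (hG k).aemeasurable,
    lintegral_crossingLaw hX hf, lintegral_crossingLaw hX hF]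
  simp only [lintegral_crossingLaw hX (hG _)]
  simp only [crossOp_add (stepLaw p) hf hs]
  rw [ENNReal.tsum_add]
  congr 1
  rw [tsum_sum_range_sub fun n k => crossOp (stepLaw p) n (G k) t]
  exact ENNReal.tsum_comm

end Walk

/-! ### The averaged jump density -/

/-- A measurable, strictly positive, even density on `ℝ` that decays exponentially in `|v|` with
rate `η`, up to the constant `C`. -/
structure IsEvenExpDensity (p : ℝ → ℝ) (C η : ℝ) : Prop where
  measurable : Measurable p
  pos : ∀ v, 0 < p v
  even : ∀ v, p (-v) = p v
  rate_pos : 0 < η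
  tail : ∀ v w, |w| ≤ |v| → p v ≤ C * Real.exp (-η * (|v| - |w|)) * p w

/-- A zero of a density forces its derivative to vanish nearby, so the zero set is open and
closed. -/
lemma kick_pos {P : unitInterval → ℝ → ℝ} (hP : IsKickFamily P) (hderiv : DerivativeBound P)
    (a : unitInterval) (v : ℝ) : 0 < P a v := by
  obtain ⟨hd, μ, hμ⟩ := hderiv
  by_contra hv
  have hv0 : P a v = 0 := le_antisymm (not_lt.1 hv) (hP.nonneg a v)
  have hclopen : IsClopen {w | P a w = 0} := by
    refine ⟨isClosed_eq (hd a).continuous continuous_const, ?_⟩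
    rw [Metric.isOpen_iff]
    intro x hx
    refine ⟨1, one_pos, fun y hy => ?_⟩
    have hx0 : P a x = 0 := hx
    have key := (convex_ball x 1).is_const_of_fderivWithin_eq_zero (𝕜 := ℝ) (f := P a)
      (hd a).differentiableOn (fun w hw => ?_) hy (Metric.mem_ball_self one_pos)
    · exact key.trans hx0
    · rw [fderivWithin_of_isOpen Metric.isOpen_ball hw]
      have h1 := hμ a x w (by rw [Metric.mem_ball, Real.dist_eq] at hw; exact hw.le)
      rw [hx0, mul_zero] at h1
      have h2 : deriv (P a) w = 0 := abs_eq_zero.1 (le_antisymm h1 (abs_nonneg _))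
      ext
      simp [h2]
  have huniv := hclopen.eq_univ ⟨v, hv0⟩
  have hzero : ∀ w, P a w = 0 := fun w => by
    have : w ∈ {w | P a w = 0} := huniv ▸ mem_univ w
    exact this
  have h1 := hP.integral_eq_one a
  simp [hzero] at h1

/-- The derivative bound keeps a density comparable to its value at the origin on a fixed interval,
so a total mass of one bounds that value uniformly in the position. -/
lemma exists_kick_le {P : unitInterval → ℝ → ℝ} (hP : IsKickFamily P) (htail : ExponentialTails P)
    (hderiv : DerivativeBound P) : ∃ M : ℝ, ∀ a v, P a v ≤ M := by
  have hpos := kick_pos hP hderiv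
  obtain ⟨C, η, hη, hC⟩ := htail
  obtain ⟨hd, μ, hμ⟩ := hderiv
  have hμ0 : 0 ≤ μ := by
    have h1 := (abs_nonneg _).trans (hμ 0 0 0 (by simp))
    have h2 := hpos 0 0
    rw [abs_zero, add_zero, mul_one] at h1
    exact nonneg_of_mul_nonneg_left h1 h2
  have hC0 : 0 ≤ C := by
    have h1 := hC 0 0 0 le_rfl
    have h2 := hpos 0 0
    simp only [sub_self, mul_zero, Real.exp_zero, mul_one] at h1
    nlinarith
  -- on `[0, δ]` the density stays above half of its value at the origin
  set δ : ℝ := 1 / (2 * (μ + 1)) with hδ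
  have hδ0 : 0 < δ := by positivity
  have hδ1 : δ ≤ 1 := by rw [hδ, div_le_one (by positivity)]; linarith
  have hδμ : μ * δ ≤ 1 / 2 := by
    rw [hδ, mul_one_div, div_le_div_iff₀ (by positivity) two_pos]; linarith
  have hzero : ∀ a, P a 0 ≤ 2 / δ := by
    intro a
    have hlow : ∀ w ∈ Icc 0 δ, P a 0 / 2 ≤ P a w := by
      intro w hw
      have h1 := (convex_Icc (0 : ℝ) δ).norm_image_sub_le_of_norm_deriv_le (f := P a)
        (C := μ * P a 0) (fun x _ => (hd a) x) (fun x hx => ?_) ⟨le_rfl, hδ0.le⟩ hw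
      · rw [Real.norm_eq_abs, Real.norm_eq_abs, sub_zero, abs_of_nonneg hw.1] at h1
        have h2 := (abs_le.1 h1).1
        have h3 : μ * P a 0 * w ≤ P a 0 / 2 := by
          calc μ * P a 0 * w ≤ μ * P a 0 * δ :=
                mul_le_mul_of_nonneg_left hw.2 (mul_nonneg hμ0 (hpos a 0).le)
            _ = P a 0 * (μ * δ) := by ring
            _ ≤ P a 0 * (1 / 2) := mul_le_mul_of_nonneg_left hδμ (hpos a 0).le
            _ = P a 0 / 2 := by ring
        linarith
      · have := hμ a 0 x (by rw [sub_zero, abs_of_nonneg hx.1]; linarith [hx.2])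
        simpa using this
    have hint : Integrable (P a) := by
      by_contra h
      have := hP.integral_eq_one a
      rw [integral_undef h] at this
      exact zero_ne_one this
    have h2 : ∫ _ in Icc 0 δ, P a 0 / 2 ≤ ∫ w in Icc 0 δ, P a w :=
      setIntegral_mono_on (by simp) hint.integrableOn measurableSet_Icc hlow
    have h3 : ∫ w in Icc 0 δ, P a w ≤ 1 := by
      rw [← hP.integral_eq_one a]
      exact setIntegral_le_integral hint (Eventually.of_forall (hP.nonneg a))
    rw [setIntegral_const, Measure.real, Real.volume_Icc, sub_zero, ENNReal.toReal_ofReal hδ0.le,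
      smul_eq_mul] at h2
    rw [le_div_iff₀ hδ0]
    linarith
  refine ⟨C * (2 / δ), fun a v => ?_⟩
  have h1 := hC a v 0 (by simp)
  have h2 : Real.exp (-η * (|v| - |(0 : ℝ)|)) ≤ 1 :=
    Real.exp_le_one_iff.2 (by rw [abs_zero, sub_zero]; nlinarith [abs_nonneg v])
  calc P a v ≤ C * Real.exp (-η * (|v| - |(0 : ℝ)|)) * P a 0 := h1
    _ ≤ C * 1 * (2 / δ) := by
        have := hzero a
        have := (hpos a 0).le
        gcongr
    _ = C * (2 / δ) := by ring

lemma isEvenExpDensity_averagedDensity {R : ℝ} (hR : 0 < R) {κ : unitInterval → ℝ}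
    (hκ : IsCoin κ) {P : unitInterval → ℝ → ℝ} (hP : IsKickFamily P)
    (hsymm : SymmetricRates (jumpRate R κ P)) (htail : ExponentialTails P)
    (hderiv : DerivativeBound P) :
    ∃ C η, IsEvenExpDensity (averagedDensity κ P) C η := by
  have hpos := kick_pos hP hderiv
  obtain ⟨M, hM⟩ := exists_kick_le hP htail hderiv
  obtain ⟨C, η, hη, hC⟩ := htail
  obtain ⟨ν, hν0, hν⟩ := hκ.lower
  have hκpos : ∀ a, 0 < κ a := fun a => hν0.trans_le (hν a)
  have hκint : Integrable κ := by
    refine Integrable.of_bound hκ.measurable.aestronglyMeasurable 1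
      (Eventually.of_forall fun a => ?_)
    rw [Real.norm_eq_abs, abs_of_pos (hκpos a)]
    exact hκ.le_one a
  have hbar : 0 < ∫ a, κ a := by
    refine hν0.trans_le ?_
    calc ν = ∫ _ : unitInterval, ν := by simp
      _ ≤ _ := integral_mono (integrable_const _) hκint hν
  set κb := ∫ a, κ a
  have hPm : ∀ v, Measurable fun a => P a v := fun v => hP.measurable.comp measurable_prodMk_right
  have hint : ∀ v, Integrable fun a => κ a / κb * P a v := by
    intro v
    refine Integrable.of_bound
      ((hκ.measurable.div_const _).mul (hPm v)).aestronglyMeasurable (1 / κb * M)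
      (Eventually.of_forall fun a => ?_)
    rw [Real.norm_eq_abs, abs_of_nonneg (mul_nonneg (div_nonneg (hκpos a).le hbar.le)
      (hP.nonneg a v))]
    have h1 := hκ.le_one a
    have h2 := hM a v
    have h3 := hP.nonneg a v
    gcongr
  have hpint : ∀ v, averagedDensity κ P v = ∫ a, κ a / κb * P a v := fun v => rfl
  refine ⟨C, η, ?_, fun v => ?_, fun v => ?_, hη, fun v w hvw => ?_⟩
  · have h1 : Measurable fun z : ℝ × unitInterval => κ z.2 / κb * P z.2 z.1 :=
      ((hκ.measurable.comp measurable_snd).div_const _).mul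
        (hP.measurable.comp (measurable_snd.prodMk measurable_fst))
    exact h1.stronglyMeasurable.integral_prod_right'.measurable
  · rw [hpint, integral_pos_iff_support_of_nonneg
      (fun a => mul_nonneg (div_nonneg (hκpos a).le hbar.le) (hP.nonneg a v)) (hint v)]
    have : (Function.support fun a => κ a / κb * P a v) = univ :=
      eq_univ_of_forall fun a => (mul_pos (div_pos (hκpos a) hbar) (hpos a v)).ne'
    rw [this]
    simp
  · rw [hpint, hpint]
    refine integral_congr_ae (Eventually.of_forall fun a => ?_)
    have h1 := hsymm a v
    simp only [jumpRate] at h1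
    have h2 := mul_left_cancel₀ (mul_pos hR (hκpos a)).ne' h1
    simp only [h2]
  · rw [hpint, hpint, ← integral_const_mul]
    refine integral_mono (hint v) ((hint w).const_mul _) fun a => ?_
    calc κ a / κb * P a v ≤ κ a / κb * (C * Real.exp (-η * (|v| - |w|)) * P a w) :=
          mul_le_mul_of_nonneg_left (hC a v w hvw) (div_nonneg (hκpos a).le hbar.le)
      _ = _ := by ring

lemma IsEvenExpDensity.one_le {p : ℝ → ℝ} {C η : ℝ} (h : IsEvenExpDensity p C η) : 1 ≤ C := by
  have h1 := h.tail 0 0 le_rfl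
  have h2 := h.pos 0
  simp only [sub_self, mul_zero, Real.exp_zero, mul_one] at h1
  exact le_of_mul_le_mul_right (by linarith) h2

/-- Monotone decay up to a constant bounds a positive density from below on bounded sets. -/
lemma IsEvenExpDensity.exists_le {p : ℝ → ℝ} {C η : ℝ} (h : IsEvenExpDensity p C η) (M : ℝ) :
    ∃ c, 0 < c ∧ ∀ v, |v| ≤ M → c ≤ p v := by
  have hC := h.one_le
  refine ⟨p |M| / C, div_pos (h.pos _) (by linarith), fun v hv => ?_⟩
  have hvM : |v| ≤ |(|M|)| := by rw [abs_abs]; exact hv.trans (le_abs_self M)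
  have h1 := h.tail |M| v hvM
  have h2 : Real.exp (-η * (|(|M|)| - |v|)) ≤ 1 :=
    Real.exp_le_one_iff.2 (by nlinarith [h.rate_pos])
  rw [div_le_iff₀ (by linarith)]
  calc p |M| ≤ C * Real.exp (-η * (|(|M|)| - |v|)) * p v := h1
    _ ≤ C * 1 * p v := by have := (h.pos v).le; gcongr
    _ = p v * C := by ring

/-! ### Every level is crossed almost surely -/

section Recurrence

variable {Ω : Type*} [MeasurableSpace Ω] {Pr : Measure Ω} {X : ℕ → Ω → ℝ} {p : ℝ → ℝ} {C η : ℝ}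

lemma IsIIDWithDensity.neg (hX : IsIIDWithDensity Pr X p) (hp : IsEvenExpDensity p C η) :
    IsIIDWithDensity Pr (fun n ω => -X n ω) p := by
  refine ⟨fun n => (hX.measurable n).neg, hX.indep.comp (fun _ x => -x) fun _ => measurable_neg,
    fun n => ?_⟩
  have h1 : Pr.map (fun ω => -X n ω) = (Pr.map (X n)).map (fun x => -x) := by
    rw [Measure.map_map measurable_neg (hX.measurable n)]
    rfl
  rw [h1, hX.law n]
  ext s hs
  rw [Measure.map_apply measurable_neg hs, withDensity_apply _ (measurable_neg hs),
    withDensity_apply _ hs, ← lintegral_indicator (measurable_neg hs), ← lintegral_indicator hs,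
    ← lintegral_neg_eq_self]
  refine lintegral_congr fun x => ?_
  have hx : -x ∈ (fun x : ℝ => -x) ⁻¹' s ↔ x ∈ s := by rw [mem_preimage, neg_neg]
  by_cases h : x ∈ s
  · rw [indicator_of_mem h, indicator_of_mem (hx.2 h), hp.even]
  · rw [indicator_of_notMem h, indicator_of_notMem (mt hx.1 h)]

lemma absolutelyContinuous_stepLaw (hp : IsEvenExpDensity p C η) : volume ≪ stepLaw p :=
  withDensity_absolutelyContinuous' hp.measurable.ennreal_ofReal.aemeasurable
    (Eventually.of_forall fun v => (ENNReal.ofReal_pos.2 (hp.pos v)).ne')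

lemma iUnion_crossingEvent {Ω : Type*} (X : ℕ → Ω → ℝ) (L : ℝ) :
    ⋃ n, crossingEvent X L n = {ω | ∃ n, L ≤ walk X (n + 1) ω} := by
  classical
  ext ω
  simp only [mem_iUnion, crossingEvent, mem_ofPred_eq]
  constructor
  · rintro ⟨n, h, -⟩
    exact ⟨n, h⟩
  · intro h
    refine ⟨Nat.find h, Nat.find_spec h, fun r h1 h2 => ?_⟩
    have := Nat.find_min h (m := r - 1) (by omega)
    rw [Nat.sub_add_cancel h1] at this
    exact not_le.1 this

lemma pairwise_disjoint_crossingEvent {Ω : Type*} (X : ℕ → Ω → ℝ) (L : ℝ) :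
    Pairwise (Function.onFun Disjoint (crossingEvent X L)) := by
  intro m n hmn
  rw [Function.onFun, Set.disjoint_left]
  rintro ω ⟨h1, h2⟩ ⟨h3, h4⟩
  rcases lt_or_gt_of_ne hmn with h | h
  · exact absurd (h4 (m + 1) (by omega) (by omega)) (not_lt.2 h1)
  · exact absurd (h2 (n + 1) (by omega) (by omega)) (not_lt.2 h3)

lemma crossingLaw_univ (hX : ∀ n, Measurable (X n)) (L : ℝ) :
    crossingLaw Pr X L univ = Pr {ω | ∃ n, L ≤ walk X (n + 1) ω} := by
  rw [crossingLaw, Measure.sum_apply _ MeasurableSet.univ, ← iUnion_crossingEvent,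
    measure_iUnion (pairwise_disjoint_crossingEvent X L)
      fun n => measurableSet_crossingEvent hX L n]
  refine tsum_congr fun n => ?_
  rw [Measure.map_apply (((measurable_walk hX _).sub_const L).prodMk (hX n)) MeasurableSet.univ]
  simp

/-- The event that the walk is unbounded above. -/
def unboundedAbove {Ω : Type*} (X : ℕ → Ω → ℝ) : Set Ω := {ω | ∀ M : ℕ, ∃ n, (M : ℝ) ≤ walk X n ω}

lemma unboundedAbove_shift {Ω : Type*} (X : ℕ → Ω → ℝ) :
    unboundedAbove (fun n => X (n + 1)) = unboundedAbove X := by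
  ext ω
  constructor
  · intro h M
    obtain ⟨M', hM'⟩ := exists_nat_ge (M + |X 0 ω|)
    obtain ⟨n, hn⟩ := h M'
    refine ⟨n + 1, ?_⟩
    rw [walk_succ']
    linarith [neg_abs_le (X 0 ω)]
  · intro h M
    obtain ⟨M', hM'⟩ := exists_nat_gt (M + |X 0 ω|)
    obtain ⟨n, hn⟩ := h M'
    have hM0 : (0 : ℝ) < M' := lt_of_le_of_lt (by positivity) hM'
    cases n with
    | zero =>
      simp only [walk, Finset.range_zero, Finset.sum_empty] at hn
      linarith
    | succ n =>
      refine ⟨n, ?_⟩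
      rw [walk_succ'] at hn
      linarith [le_abs_self (X 0 ω)]

lemma unboundedAbove_shift_add {Ω : Type*} (X : ℕ → Ω → ℝ) (k : ℕ) :
    unboundedAbove (fun n => X (n + k)) = unboundedAbove X := by
  induction k with
  | zero => rfl
  | succ k ih =>
    rw [← ih, ← unboundedAbove_shift fun n => X (n + k)]
    congr 1
    ext n
    rw [show n + 1 + k = n + (k + 1) by ring]

/-- Unboundedness of the walk is a tail event of the jumps. -/
lemma measure_unboundedAbove_zero_or_one (hX : IsIIDWithDensity Pr X p) :
    Pr (unboundedAbove X) = 0 ∨ Pr (unboundedAbove X) = 1 := by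
  refine measure_zero_or_one_of_measurableSet_limsup_atTop
    (fun n => (hX.measurable n).comap_le) hX.indep ?_
  rw [limsup_eq_iInf_iSup_of_nat, MeasurableSpace.measurableSet_iInf]
  intro k
  rw [← unboundedAbove_shift_add X k]
  have h1 : unboundedAbove (fun n => X (n + k)) =
      ⋂ M : ℕ, ⋃ n, {ω | (M : ℝ) ≤ walk (fun n => X (n + k)) n ω} := by
    ext ω
    simp [unboundedAbove]
  rw [h1]
  refine MeasurableSet.iInter fun M => MeasurableSet.iUnion fun n => ?_
  have hw : Measurable[⨆ i, ⨆ (_ : i ≥ k), MeasurableSpace.comap (X i) inferInstance]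
      (walk (fun n => X (n + k)) n) := by
    refine @Finset.measurable_fun_sum _ _ _ _ _ _ (_) _ _ fun m _ => ?_
    rw [measurable_iff_comap_le]
    exact le_iSup₂_of_le (m + k) (by omega) le_rfl
  exact hw measurableSet_Ici

/-- By the zero-one law the walk is almost surely bounded above or almost surely unbounded above.
In the former case symmetry would make it bounded on both sides, although its jumps are
unbounded. -/
theorem measure_exists_walk_ge [IsProbabilityMeasure Pr] (hX : IsIIDWithDensity Pr X p)
    (hp : IsEvenExpDensity p C η) (L : ℝ) : Pr {ω | ∃ n, L ≤ walk X (n + 1) ω} = 1 := by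
  have hμ := isProbabilityMeasure_stepLaw hX
  rcases measure_unboundedAbove_zero_or_one hX with h | h
  · exfalso
    have hsmall : ∃ M : ℕ, Pr {ω | ∃ n, (M : ℝ) ≤ walk X (n + 1) ω} < 1 / 4 := by
      have h1 : Tendsto (fun M : ℕ => Pr {ω | ∃ n, (M : ℝ) ≤ walk X (n + 1) ω}) atTop
          (𝓝 (Pr (⋂ M : ℕ, {ω | ∃ n, (M : ℝ) ≤ walk X (n + 1) ω}))) := by
        refine tendsto_measure_iInter_atTop (fun M => ?_) ?_ ⟨0, measure_ne_top _ _⟩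
        · rw [← iUnion_crossingEvent]
          exact (MeasurableSet.iUnion fun n =>
            measurableSet_crossingEvent hX.measurable _ n).nullMeasurableSet
        · intro M M' hM ω
          rintro ⟨n, hn⟩
          exact ⟨n, le_trans (by exact_mod_cast hM) hn⟩
      have h2 : Pr (⋂ M : ℕ, {ω | ∃ n, (M : ℝ) ≤ walk X (n + 1) ω}) = 0 := by
        refine measure_mono_null (show _ ⊆ unboundedAbove X from fun ω hω M => ?_) h
        obtain ⟨n, hn⟩ := mem_iInter.1 hω M
        exact ⟨n + 1, hn⟩
      rw [h2] at h1
      exact (h1.eventually_lt_const (by norm_num)).exists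
    obtain ⟨M, hM⟩ := hsmall
    have hX' := hX.neg hp
    have hM' : Pr {ω | ∃ n, (M : ℝ) ≤ walk (fun n ω => -X n ω) (n + 1) ω} < 1 / 4 := by
      rw [← crossingLaw_univ hX.measurable, ← lintegral_one,
        lintegral_crossingLaw hX measurable_const] at hM
      rw [← crossingLaw_univ hX'.measurable, ← lintegral_one,
        lintegral_crossingLaw hX' measurable_const]
      exact hM
    set q := stepLaw p (Iio (2 * M : ℝ)) with hq
    have hq1 : q < 1 := by
      have h0 : stepLaw p (Iio (2 * M : ℝ))ᶜ ≠ 0 := by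
        intro h0
        have := absolutelyContinuous_stepLaw hp h0
        simp at this
      rw [hq, ← compl_compl (Iio (2 * M : ℝ)), prob_compl_eq_one_sub measurableSet_Iio.compl]
      exact ENNReal.sub_lt_self ENNReal.one_ne_top one_ne_zero h0
    have hpow : ∀ N : ℕ, Pr (⋂ n ∈ Finset.range N, X n ⁻¹' Iio (2 * M : ℝ)) = q ^ N := by
      intro N
      rw [hX.indep.meas_biInter fun n _ => ⟨_, measurableSet_Iio, rfl⟩]
      rw [Finset.prod_congr rfl fun n _ => show Pr (X n ⁻¹' Iio (2 * M : ℝ)) = q by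
        rw [hq, stepLaw, ← hX.law n, Measure.map_apply (hX.measurable n) measurableSet_Iio]]
      simp
    -- a walk confined to `(-M, M)` has no jump of size `2 M` or more
    have hcover : ∀ N : ℕ, 1 ≤ 1 / 4 + 1 / 4 + q ^ N := by
      intro N
      have hsub : univ ⊆ ({ω | ∃ n, (M : ℝ) ≤ walk X (n + 1) ω} ∪
          {ω | ∃ n, (M : ℝ) ≤ walk (fun n ω => -X n ω) (n + 1) ω}) ∪
          ⋂ n ∈ Finset.range N, X n ⁻¹' Iio (2 * M : ℝ) := by
        intro ω _
        by_contra hω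
        simp only [mem_union, mem_ofPred_eq, not_or, not_exists, not_le, mem_iInter, not_forall,
          mem_preimage, mem_Iio, not_lt] at hω
        obtain ⟨⟨h1, h2⟩, n, -, hn⟩ := hω
        have hneg : ∀ k, walk (fun n ω => -X n ω) k ω = -walk X k ω := fun k => by
          simp [walk]
        simp only [hneg] at h2
        have h3 := h1 n
        rw [walk, Finset.sum_range_succ, ← walk] at h3
        have h4 : -(M : ℝ) ≤ walk X n ω := by
          cases n with
          | zero => simp [walk]
          | succ k => linarith [h2 k]
        linarith
      calc 1 = Pr univ := measure_univ.symm
        _ ≤ _ := measure_mono hsub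
        _ ≤ _ := measure_union_le _ _
        _ ≤ _ := add_le_add (measure_union_le _ _) le_rfl
        _ ≤ _ := by
          rw [hpow N]
          exact add_le_add (add_le_add hM.le hM'.le) le_rfl
    have hlim : Tendsto (fun N : ℕ => (1 / 4 + 1 / 4 + q ^ N : ℝ≥0∞)) atTop
        (𝓝 (1 / 4 + 1 / 4 + 0)) :=
      (ENNReal.tendsto_pow_atTop_nhds_zero_of_lt_one hq1).const_add _
    have hle := ge_of_tendsto' hlim hcover
    rw [add_zero, ← ENNReal.add_div, ENNReal.le_div_iff_mul_le (by simp) (by simp)] at hle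
    norm_num at hle
  · refine le_antisymm prob_le_one (h ▸ measure_mono fun ω hω => ?_)
    obtain ⟨M, hM⟩ := exists_nat_ge (max L 1)
    obtain ⟨n, hn⟩ := hω M
    have hM1 : (1 : ℝ) ≤ M := (le_max_right _ _).trans hM
    cases n with
    | zero =>
      simp only [walk, Finset.range_zero, Finset.sum_empty] at hn
      linarith
    | succ n => exact ⟨n, ((le_max_left _ _).trans hM).trans hn⟩

lemma isProbabilityMeasure_crossingLaw [IsProbabilityMeasure Pr] (hX : IsIIDWithDensity Pr X p)
    (hp : IsEvenExpDensity p C η) (L : ℝ) : IsProbabilityMeasure (crossingLaw Pr X L) :=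
  ⟨by rw [crossingLaw_univ hX.measurable, measure_exists_walk_ge hX hp]⟩

end Recurrence

/-! ### Overshoot tails and a common component of the crossing laws -/

section Overshoot

variable {Ω : Type*} [MeasurableSpace Ω] {Pr : Measure Ω} {X : ℕ → Ω → ℝ} {p : ℝ → ℝ} {C η : ℝ}

lemma lintegral_comp_half_add {F : ℝ → ℝ≥0∞} (hF : Measurable F) (b : ℝ) :
    ∫⁻ x, F (x / 2 + b) = 2 * ∫⁻ y, F y := by
  have h1 : ∫⁻ x, F (x / 2 + b) = ∫⁻ y, F (y + b) ∂(volume.map fun x : ℝ => 2⁻¹ * x) := by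
    rw [lintegral_map (by fun_prop) (by fun_prop)]
    simp only [div_eq_inv_mul]
  rw [h1, Real.map_volume_mul_left (by norm_num), lintegral_smul_measure,
    lintegral_add_right_eq_self (μ := volume) F b]
  simp

/-- An exponential weight on the state, a function of the overshoot only. -/
noncomputable def overshootWeight (θ : ℝ) (z : ℝ × ℝ) : ℝ≥0∞ :=
  ENNReal.ofReal (Real.exp (θ * |z.1|))

lemma measurable_overshootWeight (θ : ℝ) : Measurable (overshootWeight θ) := by
  unfold overshootWeight
  fun_prop

lemma measurable_if_le (t : ℝ) {g : ℝ → ℝ≥0∞} (hg : Measurable g) :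
    Measurable fun x => if t ≤ x then g x else 0 :=
  Measurable.ite (measurableSet_le measurable_const measurable_id) hg measurable_const

/-- The density at overshoot `u` is, up to `C e^{-ηu/2}`, at most the density at overshoot `u / 2`.
Integrating over `u` bounds an exponential moment by the total mass, whatever the level. -/
theorem lintegral_overshootWeight_le [IsProbabilityMeasure Pr] (hX : IsIIDWithDensity Pr X p)
    (hp : IsEvenExpDensity p C η) {t : ℝ} (ht : 0 ≤ t) :
    ∫⁻ z, overshootWeight (η / 2) z ∂crossingLaw Pr X t ≤ ENNReal.ofReal (2 * C) := by
  have hprob := isProbabilityMeasure_crossingLaw hX hp t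
  have hC0 : 0 ≤ C := zero_le_one.trans hp.one_le
  have hpm : Measurable fun v => ENNReal.ofReal (p v) := hp.measurable.ennreal_ofReal
  have key : ∀ t, 0 ≤ t → crossOp (stepLaw p) 0 (overshootWeight (η / 2)) t ≤
      ENNReal.ofReal (2 * C) * crossOp (stepLaw p) 0 (fun _ => 1) t := by
    intro t ht
    simp only [crossOp]
    have hm1 := measurable_if_le t (g := fun x => overshootWeight (η / 2) (x - t, x))
      ((measurable_overshootWeight _).comp (by fun_prop))
    have hm2 := measurable_if_le t (g := fun _ => 1) measurable_const
    rw [lintegral_withDensity_eq_lintegral_mul _ hpm hm1,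
      lintegral_withDensity_eq_lintegral_mul _ hpm hm2]
    have h2 := lintegral_comp_half_add (hpm.mul hm2) (t / 2)
    rw [ENNReal.ofReal_mul zero_le_two, ENNReal.ofReal_ofNat, mul_right_comm, ← h2,
      mul_comm _ (ENNReal.ofReal C),
      ← lintegral_const_mul' _ _ ENNReal.ofReal_ne_top]
    refine lintegral_mono fun x => ?_
    simp only [Pi.mul_apply]
    by_cases hx : t ≤ x
    · rw [if_pos hx, if_pos (by linarith), mul_one, overshootWeight,
        ← ENNReal.ofReal_mul (hp.pos x).le, ← ENNReal.ofReal_mul hC0]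
      refine ENNReal.ofReal_le_ofReal ?_
      have hx0 : 0 ≤ x := ht.trans hx
      have h3 := hp.tail x (x / 2 + t / 2) (by
        rw [abs_of_nonneg hx0, abs_of_nonneg (by linarith)]; linarith)
      rw [abs_of_nonneg hx0, abs_of_nonneg (show 0 ≤ x / 2 + t / 2 by linarith)] at h3
      simp only
      rw [abs_of_nonneg (sub_nonneg.2 hx)]
      calc p x * Real.exp (η / 2 * (x - t))
          ≤ C * Real.exp (-η * (x - (x / 2 + t / 2))) * p (x / 2 + t / 2) *
            Real.exp (η / 2 * (x - t)) := by gcongr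
        _ = C * p (x / 2 + t / 2) *
            (Real.exp (-η * (x - (x / 2 + t / 2))) * Real.exp (η / 2 * (x - t))) := by ring
        _ = C * p (x / 2 + t / 2) := by
          rw [← Real.exp_add, show -η * (x - (x / 2 + t / 2)) + η / 2 * (x - t) = 0 by ring,
            Real.exp_zero, mul_one]
    · rw [if_neg hx, mul_zero]
      exact zero_le
  calc ∫⁻ z, overshootWeight (η / 2) z ∂crossingLaw Pr X t
      = ∑' n, crossOp (stepLaw p) n (overshootWeight (η / 2)) t :=
        lintegral_crossingLaw hX (measurable_overshootWeight _) t
    _ ≤ ∑' n, ENNReal.ofReal (2 * C) * crossOp (stepLaw p) n (fun _ => 1) t :=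
        ENNReal.tsum_le_tsum fun n => crossOp_le_mul _ ENNReal.ofReal_ne_top key n t ht
    _ = ENNReal.ofReal (2 * C) := by
        rw [ENNReal.tsum_mul_left, ← lintegral_crossingLaw hX measurable_const]
        simp

/-- For levels in a bounded interval away from the origin, the crossings with two jumps give all the
crossing laws a common nonzero component. -/
theorem exists_le_crossingLaw [IsProbabilityMeasure Pr] (hX : IsIIDWithDensity Pr X p)
    (hp : IsEvenExpDensity p C η) (B : ℝ) :
    ∃ ν : Measure (ℝ × ℝ), ν univ ≠ 0 ∧ ∀ t ∈ Icc 1 B, ν ≤ crossingLaw Pr X t := by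
  have hprob := isProbabilityMeasure_stepLaw hX
  -- the target box has overshoot in `[0, 1)` and crossing jump in `[1, 2]`; the first jump is then
  -- of size at most `B + 3`
  obtain ⟨c, hc0, hc⟩ := hp.exists_le (B + 3)
  have hpm : Measurable fun v => ENNReal.ofReal (p v) := hp.measurable.ennreal_ofReal
  let box : Set (ℝ × ℝ) := Ico 0 1 ×ˢ Icc 1 2
  have hbox : MeasurableSet box := measurableSet_Ico.prod measurableSet_Icc
  refine ⟨(ENNReal.ofReal c * ENNReal.ofReal c) • (volume : Measure (ℝ × ℝ)).restrict box, ?_, ?_⟩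
  · rw [Measure.smul_apply, Measure.restrict_apply_univ, Measure.volume_eq_prod,
      Measure.prod_prod, Real.volume_Ico, Real.volume_Icc, smul_eq_mul]
    have : ENNReal.ofReal c ≠ 0 := (ENNReal.ofReal_pos.2 hc0).ne'
    refine mul_ne_zero (mul_ne_zero this this) ?_
    norm_num
  · rintro t ⟨ht1, htB⟩
    rw [Measure.le_iff]
    intro s hs
    let f : ℝ × ℝ → ℝ≥0∞ := s.indicator 1
    have hf : Measurable f := measurable_one.indicator hs
    let g : ℝ × ℝ → ℝ≥0∞ := box.indicator f
    have hg : Measurable g := hf.indicator hbox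
    have hm1 : Measurable fun x => if x < t then crossOp (stepLaw p) 0 f (t - x) else 0 :=
      Measurable.ite (measurableSet_lt measurable_id measurable_const)
        ((measurable_crossOp (stepLaw p) 0 hf).comp (by fun_prop)) measurable_const
    have hm2 : ∀ r, Measurable fun x => if r ≤ x then f (x - r, x) else 0 := fun r =>
      measurable_if_le r (hf.comp (by fun_prop))
    have hLHS : ((ENNReal.ofReal c * ENNReal.ofReal c) •
        (volume : Measure (ℝ × ℝ)).restrict box) s =
        ∫⁻ y, ∫⁻ x, ENNReal.ofReal c * ENNReal.ofReal c * g (y + (x - t), x) := by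
      have h1 : (volume : Measure (ℝ × ℝ)).restrict box s = ∫⁻ z, g z := by
        rw [lintegral_indicator hbox, lintegral_indicator_one hs]
      rw [Measure.smul_apply, h1, smul_eq_mul, Measure.volume_eq_prod,
        lintegral_prod_symm _ hg.aemeasurable]
      have h2 : ∀ x : ℝ, ∫⁻ v, g (v, x) = ∫⁻ y, g (y + (x - t), x) := fun x =>
        (lintegral_add_right_eq_self (fun v => g (v, x)) (x - t)).symm
      simp only [h2]
      rw [lintegral_lintegral_swap, ← lintegral_const_mul]
      · refine lintegral_congr fun y => ?_
        rw [lintegral_const_mul' _ _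
          (ENNReal.mul_ne_top ENNReal.ofReal_ne_top ENNReal.ofReal_ne_top)]
      · exact Measurable.lintegral_prod_right' (f := fun z : ℝ × ℝ => g (z.1 + (z.2 - t), z.2))
          (hg.comp (by fun_prop))
      · exact (hg.comp (by fun_prop : Measurable fun z : ℝ × ℝ =>
          (z.2 + (z.1 - t), z.1))).aemeasurable
    have hRHS : crossOp (stepLaw p) 1 f t = ∫⁻ y, ENNReal.ofReal (p y) *
        (if y < t then ∫⁻ x, ENNReal.ofReal (p x) *
          (if t - y ≤ x then f (x - (t - y), x) else 0) else 0) := by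
      rw [crossOp, lintegral_withDensity_eq_lintegral_mul _ hpm hm1]
      refine lintegral_congr fun y => ?_
      rw [Pi.mul_apply, crossOp, lintegral_withDensity_eq_lintegral_mul _ hpm (hm2 _)]
      rfl
    calc ((ENNReal.ofReal c * ENNReal.ofReal c) •
          (volume : Measure (ℝ × ℝ)).restrict box) s
        ≤ crossOp (stepLaw p) 1 f t := by
          rw [hLHS, hRHS]
          refine lintegral_mono fun y => ?_
          by_cases hy : y < t
          · rw [if_pos hy, ← lintegral_const_mul' _ _ ENNReal.ofReal_ne_top]
            refine lintegral_mono fun x => ?_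
            by_cases hb : (y + (x - t), x) ∈ box
            · have hb' := hb
              simp only [box, mem_prod, mem_Ico, mem_Icc] at hb'
              obtain ⟨⟨hv0, hv1⟩, hx1, hx2⟩ := hb'
              simp only [g]
              rw [indicator_of_mem hb, if_pos (by linarith),
                show x - (t - y) = y + (x - t) by ring, ← mul_assoc]
              gcongr
              · exact hc y (abs_le.2 ⟨by linarith, by linarith⟩)
              · exact hc x (abs_le.2 ⟨by linarith, by linarith⟩)
            · simp only [g]
              rw [indicator_of_notMem hb, mul_zero]
              exact zero_le
          · have : ∀ x, g (y + (x - t), x) = 0 := fun x => by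
              refine indicator_of_notMem (fun hb => hy ?_) _
              simp only [box, mem_prod, mem_Ico, mem_Icc] at hb
              linarith [hb.1.2, hb.2.1]
            simp [this]
      _ ≤ ∑' n, crossOp (stepLaw p) n f t := ENNReal.le_tsum 1
      _ = crossingLaw Pr X t s := by
          rw [← lintegral_crossingLaw hX hf, lintegral_indicator_one hs]

end Overshoot

/-! ### The `L¹` distance by duality -/

section L1

variable {E : Type*} [MeasurableSpace E] {ρ σ : Measure E}

lemma absolutelyContinuous_add_left (ρ σ : Measure E) : ρ ≪ ρ + σ :=
  (Measure.le_add_right le_rfl).absolutelyContinuous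

lemma absolutelyContinuous_add_right (ρ σ : Measure E) : σ ≪ ρ + σ :=
  (Measure.le_add_left le_rfl).absolutelyContinuous

/-- For two probability measures, positive and negative part of the difference of the densities
have the same integral. -/
lemma l1Dist_eq_two_mul [IsProbabilityMeasure ρ] [IsProbabilityMeasure σ] :
    l1Dist ρ σ = 2 * ∫⁻ z, (ρ.rnDeriv (ρ + σ) z - σ.rnDeriv (ρ + σ) z) ∂(ρ + σ) := by
  set r := ρ.rnDeriv (ρ + σ) with hr
  set s := σ.rnDeriv (ρ + σ) with hs
  have hrm : Measurable r := Measure.measurable_rnDeriv _ _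
  have hsm : Measurable s := Measure.measurable_rnDeriv _ _
  have hr1 : ∫⁻ z, r z ∂(ρ + σ) = 1 := by
    rw [Measure.lintegral_rnDeriv (absolutelyContinuous_add_left ρ σ), measure_univ]
  have hs1 : ∫⁻ z, s z ∂(ρ + σ) = 1 := by
    rw [Measure.lintegral_rnDeriv (absolutelyContinuous_add_right ρ σ), measure_univ]
  have hsymm : ∫⁻ z, (r z - s z) ∂(ρ + σ) = ∫⁻ z, (s z - r z) ∂(ρ + σ) := by
    have h1 : ∫⁻ z, (r z - s z) ∂(ρ + σ) + 1 = ∫⁻ z, (s z - r z) ∂(ρ + σ) + 1 := by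
      conv_lhs => rw [← hs1, ←
        lintegral_add_left (show Measurable fun z => r z - s z from hrm.sub hsm)]
      conv_rhs => rw [← hr1, ←
        lintegral_add_left (show Measurable fun z => s z - r z from hsm.sub hrm)]
      refine lintegral_congr fun z => ?_
      rw [tsub_add_eq_max, tsub_add_eq_max, max_comm]
    exact (ENNReal.add_left_inj ENNReal.one_ne_top).1 h1
  have hsplit : l1Dist ρ σ = ∫⁻ z, ((r z - s z) + (s z - r z)) ∂(ρ + σ) := by
    refine lintegral_congr_ae ?_
    filter_upwards [Measure.rnDeriv_lt_top ρ (ρ + σ), Measure.rnDeriv_lt_top σ (ρ + σ)] with z h1 h2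
    change ENNReal.ofReal |(r z).toReal - (s z).toReal| = _
    rcases le_total (r z) (s z) with h | h
    · rw [tsub_eq_zero_of_le h, zero_add, abs_sub_comm,
        abs_of_nonneg (sub_nonneg.2 (ENNReal.toReal_mono h2.ne h)),
        ENNReal.ofReal_sub _ ENNReal.toReal_nonneg, ENNReal.ofReal_toReal h1.ne,
        ENNReal.ofReal_toReal h2.ne]
    · rw [tsub_eq_zero_of_le h, add_zero,
        abs_of_nonneg (sub_nonneg.2 (ENNReal.toReal_mono h1.ne h)),
        ENNReal.ofReal_sub _ ENNReal.toReal_nonneg, ENNReal.ofReal_toReal h1.ne,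
        ENNReal.ofReal_toReal h2.ne]
  rw [hsplit, lintegral_add_left (show Measurable fun z => r z - s z from hrm.sub hsm),
    ← hsymm, two_mul]

lemma two_mul_lintegral_le_add_l1Dist [IsProbabilityMeasure ρ] [IsProbabilityMeasure σ]
    {f : E → ℝ≥0∞} (hf : Measurable f) (hf1 : ∀ z, f z ≤ 1) :
    2 * ∫⁻ z, f z ∂ρ ≤ 2 * ∫⁻ z, f z ∂σ + l1Dist ρ σ := by
  rw [l1Dist_eq_two_mul, ← mul_add]
  gcongr
  rw [← lintegral_rnDeriv_mul (absolutelyContinuous_add_left ρ σ) hf.aemeasurable,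
    ← lintegral_rnDeriv_mul (absolutelyContinuous_add_right ρ σ) hf.aemeasurable,
    ← lintegral_add_left (show Measurable fun z => σ.rnDeriv (ρ + σ) z * f z from
      (Measure.measurable_rnDeriv _ _).mul hf)]
  refine lintegral_mono fun z => ?_
  calc ρ.rnDeriv (ρ + σ) z * f z
      ≤ (σ.rnDeriv (ρ + σ) z + (ρ.rnDeriv (ρ + σ) z - σ.rnDeriv (ρ + σ) z)) * f z := by
        gcongr
        exact le_add_tsub
    _ ≤ σ.rnDeriv (ρ + σ) z * f z + (ρ.rnDeriv (ρ + σ) z - σ.rnDeriv (ρ + σ) z) := by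
        rw [add_mul]
        gcongr
        exact mul_le_of_le_one_right' (hf1 z)

/-- The supremum in the dual description of the distance is attained by an indicator function. -/
lemma exists_l1Dist_le [IsProbabilityMeasure ρ] [IsProbabilityMeasure σ] :
    ∃ S : Set E, MeasurableSet S ∧ l1Dist ρ σ ≤ 2 * (ρ S - σ S) := by
  have hrm : Measurable (ρ.rnDeriv (ρ + σ)) := Measure.measurable_rnDeriv _ _
  have hsm : Measurable (σ.rnDeriv (ρ + σ)) := Measure.measurable_rnDeriv _ _
  let S := {z | σ.rnDeriv (ρ + σ) z < ρ.rnDeriv (ρ + σ) z}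
  have hS : MeasurableSet S := measurableSet_lt hsm hrm
  refine ⟨S, hS, ?_⟩
  rw [l1Dist_eq_two_mul]
  gcongr
  refine ENNReal.le_sub_of_add_le_right (measure_ne_top _ _) ?_
  rw [← Measure.setLIntegral_rnDeriv (absolutelyContinuous_add_left ρ σ) S,
    ← Measure.setLIntegral_rnDeriv (absolutelyContinuous_add_right ρ σ) S,
    ← lintegral_indicator hS, ← lintegral_indicator hS, ← lintegral_add_left
      (show Measurable fun z => ρ.rnDeriv (ρ + σ) z - σ.rnDeriv (ρ + σ) z from hrm.sub hsm)]
  refine lintegral_mono fun z => ?_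
  by_cases hz : z ∈ S
  · rw [indicator_of_mem hz, indicator_of_mem hz, tsub_add_cancel_of_le (le_of_lt hz)]
  · rw [indicator_of_notMem hz, indicator_of_notMem hz, tsub_eq_zero_of_le (not_lt.1 hz), zero_add]

end L1

/-! ### A contraction estimate for Markov operators with a Lyapunov function -/

section Contraction

variable {E : Type*} [MeasurableSpace E]

/-- Comparison of two probability measures with a common component `ν`: the oscillation of the
integrand is charged only to an independent coupling of the remainders. -/
lemma lintegral_le_of_common_part {ρ ρ' ν : Measure E} [IsProbabilityMeasure ρ]
    [IsProbabilityMeasure ρ'] (hν : ν ≤ ρ) (hν' : ν ≤ ρ') {f w : E → ℝ≥0∞} (hf : Measurable f)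
    (hw : Measurable w) {A b : ℝ≥0∞} (h : ∀ x y, f x ≤ f y + A * (2 + b * (w x + w y))) :
    ∫⁻ x, f x ∂ρ ≤ ∫⁻ x, f x ∂ρ' +
      A * (2 * (1 - ν univ) + b * (∫⁻ x, w x ∂ρ + ∫⁻ x, w x ∂ρ')) := by
  have : IsFiniteMeasure ν := isFiniteMeasure_of_le ρ hν
  set ρ₁ := ρ - ν with hρ₁
  set ρ₂ := ρ' - ν with hρ₂
  have h1 : ρ₁ + ν = ρ := Measure.sub_add_cancel_of_le hν
  have h2 : ρ₂ + ν = ρ' := Measure.sub_add_cancel_of_le hν'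
  set m := 1 - ν univ with hm
  have hm1 : ρ₁ univ = m := by
    rw [hρ₁, Measure.sub_apply MeasurableSet.univ hν, measure_univ]
  have hm2 : ρ₂ univ = m := by
    rw [hρ₂, Measure.sub_apply MeasurableSet.univ hν', measure_univ]
  have hmtop : m ≠ ∞ := (tsub_le_self.trans_lt ENNReal.one_lt_top).ne
  have key : ∫⁻ x, f x ∂ρ₁ ≤ ∫⁻ x, f x ∂ρ₂ +
      A * (2 * m + b * (∫⁻ x, w x ∂ρ₁ + ∫⁻ x, w x ∂ρ₂)) := by
    rcases eq_or_ne m 0 with hm0 | hm0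
    · rw [Measure.measure_univ_eq_zero.1 (hm1.trans hm0)]
      simp
    · rw [← ENNReal.mul_le_mul_iff_left hm0 hmtop]
      calc (∫⁻ x, f x ∂ρ₁) * m = ∫⁻ x, ∫⁻ _, f x ∂ρ₂ ∂ρ₁ := by
            simp only [lintegral_const, hm2]
            rw [lintegral_mul_const' _ _ hmtop]
        _ ≤ ∫⁻ x, ∫⁻ y, (f y + A * (2 + b * (w x + w y))) ∂ρ₂ ∂ρ₁ :=
            lintegral_mono fun x => lintegral_mono fun y => h x y
        _ = ∫⁻ x, (∫⁻ y, f y ∂ρ₂ + A * (2 * m + b * (w x * m + ∫⁻ y, w y ∂ρ₂))) ∂ρ₁ := by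
            refine lintegral_congr fun x => ?_
            rw [lintegral_add_left hf, lintegral_const_mul _ (by fun_prop),
              lintegral_add_left measurable_const, lintegral_const_mul _ (by fun_prop),
              lintegral_add_left measurable_const]
            simp only [lintegral_const, hm2]
        _ = (∫⁻ x, f x ∂ρ₂ + A * (2 * m + b * (∫⁻ x, w x ∂ρ₁ + ∫⁻ x, w x ∂ρ₂))) * m := by
            rw [lintegral_add_left measurable_const, lintegral_const_mul _ (by fun_prop),
              lintegral_add_left measurable_const,
              lintegral_const_mul (μ := ρ₁) b (hw.mul_const m |>.add_const _),
              lintegral_add_right _ measurable_const, lintegral_mul_const m hw]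
            simp only [lintegral_const, hm1]
            ring
  calc ∫⁻ x, f x ∂ρ = ∫⁻ x, f x ∂ρ₁ + ∫⁻ x, f x ∂ν := by
        conv_lhs => rw [← h1]
        exact lintegral_add_measure _ _ _
    _ ≤ ∫⁻ x, f x ∂ρ₂ + A * (2 * m + b * (∫⁻ x, w x ∂ρ₁ + ∫⁻ x, w x ∂ρ₂)) + ∫⁻ x, f x ∂ν := by
        gcongr
    _ = ∫⁻ x, f x ∂ρ' + A * (2 * m + b * (∫⁻ x, w x ∂ρ₁ + ∫⁻ x, w x ∂ρ₂)) := by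
        conv_rhs => rw [← h2]
        rw [lintegral_add_measure]
        ring
    _ ≤ _ := by
        gcongr
        · exact Measure.sub_le
        · exact Measure.sub_le

/-- A drift towards small values of the weight `w`, together with a common component of the
transition laws from points of small weight, makes a Markov operator contract the seminorm
`sup (f x - f y) / (2 + b (w x + w y))`. -/
theorem exists_contraction {κ : E → Measure E} [∀ x, IsProbabilityMeasure (κ x)] {w : E → ℝ≥0∞}
    (hw : Measurable w) (hwtop : ∀ x, w x ≠ ∞) {K : ℝ} (hK : 0 < K)
    (hdrift : ∀ x, ∫⁻ y, w y ∂κ x ≤ w x / 2 + ENNReal.ofReal K) {ν : Measure E} [IsFiniteMeasure ν]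
    (hν0 : ν univ ≠ 0) (hν : ∀ x, w x ≤ ENNReal.ofReal (16 * K) → ν ≤ κ x) :
    ∃ α b : ℝ, 0 < α ∧ α < 1 ∧ ∀ (A : ℝ≥0∞) (f : E → ℝ≥0∞), Measurable f →
      (∀ x y, f x ≤ f y + A * (2 + ENNReal.ofReal b * (w x + w y))) →
      ∀ x y, ∫⁻ z, f z ∂κ x ≤ ∫⁻ z, f z ∂κ y +
        ENNReal.ofReal α * A * (2 + ENNReal.ofReal b * (w x + w y)) := by
  set β : ℝ := min 1 (ν univ).toReal with hβ
  have hβ0 : 0 < β := lt_min one_pos (ENNReal.toReal_pos hν0 (measure_ne_top _ _))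
  have hβ1 : β ≤ 1 := min_le_left _ _
  have hβν : ENNReal.ofReal β ≤ ν univ :=
    ENNReal.ofReal_le_of_le_toReal (min_le_right _ _)
  -- `b K = β / 2` lets the common mass absorb the constant of the drift at small weights; at
  -- large weights the drift alone is a gain
  set b : ℝ := β / (2 * K) with hb
  have hb0 : 0 < b := by positivity
  have hbK : b * K = β / 2 := by rw [hb]; field_simp
  refine ⟨1 - β / 4, b, by linarith, by linarith, fun A f hf h x y => ?_⟩
  obtain ⟨u, hu0, hu⟩ : ∃ u : ℝ, 0 ≤ u ∧ w x = ENNReal.ofReal u :=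
    ⟨_, ENNReal.toReal_nonneg, (ENNReal.ofReal_toReal (hwtop x)).symm⟩
  obtain ⟨v, hv0, hv⟩ : ∃ v : ℝ, 0 ≤ v ∧ w y = ENNReal.ofReal v :=
    ⟨_, ENNReal.toReal_nonneg, (ENNReal.ofReal_toReal (hwtop y)).symm⟩
  have hdr : ∀ (z : E) (t : ℝ), 0 ≤ t → w z = ENNReal.ofReal t →
      ∫⁻ y, w y ∂κ z ≤ ENNReal.ofReal (t / 2 + K) := by
    intro z t ht hz
    refine (hdrift z).trans (le_of_eq ?_)
    rw [hz, ENNReal.ofReal_add (by positivity) hK.le, ENNReal.ofReal_div_of_pos two_pos,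
      ENNReal.ofReal_ofNat]
  have hb2 : ENNReal.ofReal b * (∫⁻ z, w z ∂κ x + ∫⁻ z, w z ∂κ y) ≤
      ENNReal.ofReal (b * ((u + v) / 2 + 2 * K)) := by
    calc _ ≤ ENNReal.ofReal b * (ENNReal.ofReal (u / 2 + K) + ENNReal.ofReal (v / 2 + K)) := by
          gcongr
          · exact hdr x u hu0 hu
          · exact hdr y v hv0 hv
      _ = _ := by
          rw [← ENNReal.ofReal_add (by positivity) (by positivity), ← ENNReal.ofReal_mul hb0.le]
          congr 1
          ring
  have hfin : ENNReal.ofReal (1 - β / 4) * A * (2 + ENNReal.ofReal b * (w x + w y)) =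
      A * ENNReal.ofReal ((1 - β / 4) * (2 + b * (u + v))) := by
    rw [hu, hv, ← ENNReal.ofReal_add hu0 hv0, ← ENNReal.ofReal_mul hb0.le,
      ENNReal.ofReal_mul (p := 1 - β / 4) (by linarith),
      ENNReal.ofReal_add (p := 2) two_pos.le (by positivity),
      ENNReal.ofReal_ofNat]
    ring
  rw [hfin]
  by_cases hsmall : w x ≤ ENNReal.ofReal (16 * K) ∧ w y ≤ ENNReal.ofReal (16 * K)
  · refine (lintegral_le_of_common_part (hν x hsmall.1) (hν y hsmall.2) hf hw h).trans ?_
    gcongr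
    have h1 : 2 * (1 - ν univ) ≤ ENNReal.ofReal (2 * (1 - β)) := by
      rw [ENNReal.ofReal_mul two_pos.le, ENNReal.ofReal_ofNat, ENNReal.ofReal_sub _ hβ0.le,
        ENNReal.ofReal_one]
      gcongr
    refine (add_le_add h1 hb2).trans ?_
    rw [← ENNReal.ofReal_add (by linarith) (by positivity)]
    refine ENNReal.ofReal_le_ofReal ?_
    have h3 : 0 ≤ b * (u + v) := by positivity
    nlinarith
  · have hlarge : 16 * K ≤ u + v := by
      by_contra hlt
      refine hsmall ⟨?_, ?_⟩
      · rw [hu]; exact ENNReal.ofReal_le_ofReal (by linarith)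
      · rw [hv]; exact ENNReal.ofReal_le_ofReal (by linarith)
    have h0 := lintegral_le_of_common_part (ν := 0) (Measure.zero_le (κ x)) (Measure.zero_le (κ y))
      hf hw h
    refine h0.trans ?_
    gcongr
    rw [Measure.coe_zero, Pi.zero_apply, tsub_zero, mul_one]
    refine (add_le_add_right hb2 _).trans ?_
    rw [← ENNReal.ofReal_ofNat, ← ENNReal.ofReal_add two_pos.le (by positivity)]
    refine ENNReal.ofReal_le_ofReal ?_
    have h3 : 8 * β ≤ b * (u + v) := by nlinarith
    nlinarith

end Contraction

/-! ### The limit law and its density -/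

section Limit

variable {Ω : Type*} [MeasurableSpace Ω] {Pr : Measure Ω} {X : ℕ → Ω → ℝ} {p : ℝ → ℝ} {C η : ℝ}

/-- A property of the pair that holds whenever a single jump from a nonnegative distance crosses the
level holds almost surely under the crossing laws. -/
lemma ae_crossingLaw [IsProbabilityMeasure Pr] (hX : IsIIDWithDensity Pr X p) {S : Set (ℝ × ℝ)}
    (hS : MeasurableSet S) (h : ∀ t, 0 ≤ t → ∀ᵐ x ∂stepLaw p, t ≤ x → (x - t, x) ∈ S)
    {t : ℝ} (ht : 0 ≤ t) : ∀ᵐ z ∂crossingLaw Pr X t, z ∈ S := by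
  rw [ae_iff]
  change crossingLaw Pr X t Sᶜ = 0
  rw [← lintegral_indicator_one hS.compl,
    lintegral_crossingLaw hX (measurable_one.indicator hS.compl), ENNReal.tsum_eq_zero]
  intro n
  have h1 := crossOp_le_mul (stepLaw p) (f := Sᶜ.indicator 1) (g := fun _ => 1)
    ENNReal.zero_ne_top (fun t ht => ?_) n t ht
  · simpa using h1
  · rw [zero_mul, crossOp, lintegral_congr_ae (g := fun _ => 0), lintegral_zero]
    filter_upwards [h t ht] with x hx
    split_ifs with htx
    · exact indicator_of_notMem (s := Sᶜ) (notMem_compl_iff.2 (hx htx)) _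
    · rfl

lemma ae_crossingLaw_nonneg_pos [IsProbabilityMeasure Pr] (hX : IsIIDWithDensity Pr X p) {t : ℝ}
    (ht : 0 ≤ t) : ∀ᵐ z ∂crossingLaw Pr X t, 0 ≤ z.1 ∧ 0 < z.2 := by
  refine ae_crossingLaw hX (S := {z | 0 ≤ z.1 ∧ 0 < z.2}) ?_ (fun t ht => ?_) ht
  · exact (measurableSet_le measurable_const measurable_fst).inter
      (measurableSet_lt measurable_const measurable_snd)
  · have h0 : ∀ᵐ x ∂stepLaw p, x ≠ 0 :=
      (withDensity_absolutelyContinuous _ _).ae_le (Measure.ae_ne volume 0)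
    filter_upwards [h0] with x hx htx
    exact ⟨sub_nonneg.2 htx, lt_of_le_of_ne (ht.trans htx) (Ne.symm hx)⟩

/-- The crossing jump has an absolutely continuous law, as every single jump does. -/
lemma map_snd_recordLaw_absolutelyContinuous [IsProbabilityMeasure Pr]
    (hX : IsIIDWithDensity Pr X p) : (recordLaw Pr X).map Prod.snd ≪ volume := by
  refine Measure.AbsolutelyContinuous.mk fun N hN hN0 => ?_
  rw [Measure.map_apply measurable_snd hN]
  have h := ae_crossingLaw hX (S := {z | z.2 ∉ N}) (measurable_snd hN).compl (fun t _ => ?_)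
    (le_refl (0 : ℝ))
  · have h' := ae_iff.1 h
    simp only [mem_ofPred_eq, not_not] at h'
    exact h'
  · have h0 : ∀ᵐ x ∂stepLaw p, x ∉ N :=
      (withDensity_absolutelyContinuous _ _).ae_le (measure_eq_zero_iff_ae_notMem.1 hN0)
    filter_upwards [h0] with x hx _ using hx

lemma meanIncrement_pos [IsProbabilityMeasure Pr] (hX : IsIIDWithDensity Pr X p)
    (hp : IsEvenExpDensity p C η) : 0 < meanIncrement (recordLaw Pr X) := by
  have hm : Measurable fun z : ℝ × ℝ => ENNReal.ofReal z.1 := by fun_prop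
  have hm0 : Measurable fun x : ℝ => if 0 ≤ x then ENNReal.ofReal (x - 0) else 0 :=
    measurable_if_le 0 (by fun_prop)
  rw [meanIncrement, recordLaw, lintegral_crossingLaw hX hm]
  refine lt_of_lt_of_le ?_ (ENNReal.le_tsum 0)
  rw [crossOp, pos_iff_ne_zero, Ne, lintegral_eq_zero_iff hm0]
  intro h
  have h1 := (absolutelyContinuous_stepLaw hp).ae_le h
  have h2 : volume (Ioi (0 : ℝ)) = 0 := by
    refine measure_mono_null (fun x hx => ?_) (ae_iff.1 h1)
    have hx' : (0 : ℝ) < x := hx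
    simp [hx'.le, hx']
  simp at h2

lemma meanIncrement_lt_top [IsProbabilityMeasure Pr] (hX : IsIIDWithDensity Pr X p)
    (hp : IsEvenExpDensity p C η) : meanIncrement (recordLaw Pr X) < ∞ := by
  have hη := hp.rate_pos
  have h1 : meanIncrement (recordLaw Pr X) ≤
      ∫⁻ z, ENNReal.ofReal (2 / η) * overshootWeight (η / 2) z ∂recordLaw Pr X := by
    refine lintegral_mono fun z => ?_
    rw [overshootWeight, ← ENNReal.ofReal_mul (by positivity)]
    refine ENNReal.ofReal_le_ofReal ?_
    have h2 := Real.add_one_le_exp (η / 2 * |z.1|)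
    calc z.1 ≤ |z.1| := le_abs_self _
      _ = 2 / η * (η / 2 * |z.1|) := by field_simp
      _ ≤ 2 / η * Real.exp (η / 2 * |z.1|) := by
          gcongr
          linarith
  refine h1.trans_lt ?_
  rw [lintegral_const_mul' _ _ ENNReal.ofReal_ne_top]
  exact ENNReal.mul_lt_top ENNReal.ofReal_lt_top
    ((lintegral_overshootWeight_le hX hp le_rfl).trans_lt ENNReal.ofReal_lt_top)

/-- The density is built from the density of the crossing jump and the conditional law of the
record increment given that jump. -/
lemma exists_isLimitDensity [IsProbabilityMeasure Pr] (hX : IsIIDWithDensity Pr X p)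
    (hp : IsEvenExpDensity p C η) : ∃ q, IsLimitDensity (recordLaw Pr X) q := by
  have hprob : IsProbabilityMeasure (recordLaw Pr X) := isProbabilityMeasure_crossingLaw hX hp 0
  set D := recordLaw Pr X
  set Ds : Measure (ℝ × ℝ) := D.map Prod.swap
  have hDs : IsProbabilityMeasure Ds :=
    Measure.isProbabilityMeasure_map measurable_swap.aemeasurable
  have hfst : Ds.fst = D.map Prod.snd := by
    rw [Measure.fst, Measure.map_map measurable_fst measurable_swap]
    rfl
  have hac : Ds.fst ≪ volume := hfst ▸ map_snd_recordLaw_absolutelyContinuous hX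
  have hker : Measurable fun z : ℝ × ℝ => Ds.condKernel z.2 (Ioi z.1) := by
    have h := Kernel.measurable_kernel_prodMk_left (κ := Ds.condKernel.comap _ measurable_snd)
      (t := {y : (ℝ × ℝ) × ℝ | y.1.1 < y.2})
      (measurableSet_lt (by fun_prop) measurable_snd)
    exact h
  refine ⟨fun v w => Ds.fst.rnDeriv volume w * Ds.condKernel w (Ioi v) * (meanIncrement D)⁻¹,
    ?_, fun v _ B hB => ?_⟩
  · exact (((Measure.measurable_rnDeriv _ _).comp measurable_snd).mul hker).mul_const _
  · have hkv : Measurable fun w => Ds.condKernel w (Ioi v) :=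
      Kernel.measurable_coe _ measurableSet_Ioi
    rw [lintegral_mul_const' _ _ (ENNReal.inv_ne_top.2 (meanIncrement_pos hX hp).ne'),
      div_eq_mul_inv]
    congr 1
    rw [setLIntegral_rnDeriv_mul hac hkv.aemeasurable hB,
      Measure.setLIntegral_condKernel_eq_measure_prod hB measurableSet_Ioi,
      Measure.map_apply measurable_swap (hB.prod measurableSet_Ioi), Set.preimage_swap_prod]

/-- Integrals against the limit law: a record increment is chosen according to its size, and the
overshoot uniformly inside it. -/
lemma lintegral_quadrantLaw [IsProbabilityMeasure Pr] (hX : IsIIDWithDensity Pr X p)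
    (hp : IsEvenExpDensity p C η) {q : ℝ → ℝ → ℝ≥0∞} (hq : IsLimitDensity (recordLaw Pr X) q)
    {f : ℝ × ℝ → ℝ≥0∞} (hf : Measurable f) :
    ∫⁻ z, f z ∂quadrantLaw q = (meanIncrement (recordLaw Pr X))⁻¹ *
      ∫⁻ z, (∫⁻ v in Ioo 0 z.1, f (v, z.2)) ∂recordLaw Pr X := by
  have hprob : IsProbabilityMeasure (recordLaw Pr X) := isProbabilityMeasure_crossingLaw hX hp 0
  have hae : ∀ᵐ z ∂recordLaw Pr X, 0 ≤ z.1 ∧ 0 < z.2 := ae_crossingLaw_nonneg_pos hX le_rfl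
  set D := recordLaw Pr X
  obtain ⟨hqm, hqD⟩ := hq
  have hm0 : meanIncrement D ≠ 0 := (meanIncrement_pos hX hp).ne'
  have hqv : ∀ v, Measurable (q v) := fun v => hqm.comp measurable_prodMk_left
  have hfv : ∀ v, Measurable fun w => f (v, w) := fun v => hf.comp measurable_prodMk_left
  have hmeas : ∀ v, 0 ≤ v → ((volume : Measure ℝ).restrict (Ioi 0)).withDensity (q v) =
      (meanIncrement D)⁻¹ • (D.restrict (Ioi v ×ˢ univ)).map Prod.snd := by
    intro v hv
    ext B hB
    rw [withDensity_apply _ hB, Measure.restrict_restrict hB,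
      hqD v hv _ (hB.inter measurableSet_Ioi), Measure.smul_apply,
      Measure.map_apply measurable_snd hB, Measure.restrict_apply (measurable_snd hB),
      smul_eq_mul, ENNReal.div_eq_inv_mul]
    congr 1
    refine measure_congr ?_
    filter_upwards [hae] with z hz
    refine propext ?_
    change (z.1 ∈ Ioi v ∧ z.2 ∈ B ∧ z.2 ∈ Ioi 0) ↔ (z.2 ∈ B ∧ z.1 ∈ Ioi v ∧ z.2 ∈ univ)
    simp only [mem_Ioi, mem_univ, and_true, hz.2]
    tauto
  have hinner : ∀ v ∈ Ioi (0 : ℝ), ∫⁻ w in Ioi 0, (Function.uncurry q * f) (v, w) =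
      (meanIncrement D)⁻¹ * ∫⁻ z, (if v < z.1 then f (v, z.2) else 0) ∂D := by
    intro v hv
    have h1 : ∫⁻ w in Ioi 0, (Function.uncurry q * f) (v, w) =
        ∫⁻ w, f (v, w) ∂((volume : Measure ℝ).restrict (Ioi 0)).withDensity (q v) := by
      rw [lintegral_withDensity_eq_lintegral_mul _ (hqv v) (hfv v)]
      rfl
    rw [h1, hmeas v (le_of_lt hv), lintegral_smul_measure, lintegral_map (hfv v) measurable_snd,
      smul_eq_mul, ← lintegral_indicator (measurableSet_Ioi.prod MeasurableSet.univ)]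
    congr 1
    refine lintegral_congr fun z => ?_
    by_cases hz : v < z.1
    · rw [if_pos hz, indicator_of_mem (show z ∈ Ioi v ×ˢ univ from ⟨hz, mem_univ _⟩)]
    · rw [if_neg hz, indicator_of_notMem fun h => hz h.1]
  rw [quadrantLaw, lintegral_withDensity_eq_lintegral_mul _ hqm hf, Measure.volume_eq_prod,
    ← Measure.prod_restrict, lintegral_prod _ (hqm.mul hf).aemeasurable,
    setLIntegral_congr_fun measurableSet_Ioi hinner,
    lintegral_const_mul' _ _ (ENNReal.inv_ne_top.2 hm0), lintegral_lintegral_swap]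
  · congr 1
    refine lintegral_congr fun z => ?_
    rw [← lintegral_indicator measurableSet_Ioi, ← lintegral_indicator measurableSet_Ioo]
    refine lintegral_congr fun v => ?_
    by_cases h1 : 0 < v <;> by_cases h2 : v < z.1 <;> simp [indicator, h1, h2]
  · exact (Measurable.ite (measurableSet_lt measurable_fst (by fun_prop)) (by fun_prop)
      measurable_const).aemeasurable

lemma isProbabilityMeasure_quadrantLaw [IsProbabilityMeasure Pr] (hX : IsIIDWithDensity Pr X p)
    (hp : IsEvenExpDensity p C η) {q : ℝ → ℝ → ℝ≥0∞} (hq : IsLimitDensity (recordLaw Pr X) q) :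
    IsProbabilityMeasure (quadrantLaw q) := by
  refine ⟨?_⟩
  rw [← lintegral_one, lintegral_quadrantLaw hX hp hq measurable_const]
  have h1 : ∫⁻ z, (∫⁻ _ in Ioo (0 : ℝ) z.1, (1 : ℝ≥0∞)) ∂recordLaw Pr X =
      meanIncrement (recordLaw Pr X) := by
    refine lintegral_congr fun z => ?_
    rw [setLIntegral_one, Real.volume_Ioo, sub_zero]
  rw [h1]
  exact ENNReal.inv_mul_cancel (meanIncrement_pos hX hp).ne' (meanIncrement_lt_top hX hp).ne

lemma lintegral_overshootWeight_quadrantLaw_ne_top [IsProbabilityMeasure Pr]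
    (hX : IsIIDWithDensity Pr X p) (hp : IsEvenExpDensity p C η) {q : ℝ → ℝ → ℝ≥0∞}
    (hq : IsLimitDensity (recordLaw Pr X) q) :
    ∫⁻ z, overshootWeight (η / 2) z ∂quadrantLaw q ≠ ∞ := by
  have hη := hp.rate_pos
  rw [lintegral_quadrantLaw hX hp hq (measurable_overshootWeight _)]
  refine ENNReal.mul_ne_top (ENNReal.inv_ne_top.2 (meanIncrement_pos hX hp).ne') ?_
  have h1 : ∀ z : ℝ × ℝ, ∫⁻ v in Ioo 0 z.1, overshootWeight (η / 2) (v, z.2) ≤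
      ENNReal.ofReal (2 / η) * overshootWeight (η / 2) z := by
    intro z
    rcases le_total z.1 0 with hz | hz
    · rw [Ioo_eq_empty (not_lt.2 hz)]
      simp
    · have h2 : ∫⁻ v in Ioo 0 z.1, overshootWeight (η / 2) (v, z.2) =
          ∫⁻ v in Ioc 0 z.1, ENNReal.ofReal (Real.exp (η / 2 * v)) := by
        rw [setLIntegral_congr Ioo_ae_eq_Ioc]
        refine setLIntegral_congr_fun measurableSet_Ioc fun v hv => ?_
        simp only [overshootWeight, abs_of_pos hv.1]
      have hcont : Continuous fun v : ℝ => Real.exp (η / 2 * v) := by fun_prop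
      have hint : IntegrableOn (fun v : ℝ => Real.exp (η / 2 * v)) (Ioc 0 z.1) :=
        (hcont.integrableOn_Icc).mono_set Ioc_subset_Icc_self
      rw [h2, ← ofReal_integral_eq_lintegral_ofReal hint
        (Eventually.of_forall fun v => (Real.exp_pos _).le), overshootWeight,
        ← ENNReal.ofReal_mul (by positivity), ← intervalIntegral.integral_of_le hz,
        intervalIntegral.integral_comp_mul_left (fun v => Real.exp v) (by positivity),
        integral_exp, abs_of_nonneg hz, mul_zero, Real.exp_zero, smul_eq_mul, inv_div]
      refine ENNReal.ofReal_le_ofReal ?_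
      have : 0 < 2 / η := by positivity
      nlinarith
  refine ((lintegral_mono h1).trans_lt ?_).ne
  rw [lintegral_const_mul' _ _ ENNReal.ofReal_ne_top]
  exact ENNReal.mul_lt_top ENNReal.ofReal_lt_top
    ((lintegral_overshootWeight_le hX hp le_rfl).trans_lt ENNReal.ofReal_lt_top)

/-! ### Stationarity of the limit law -/

/-- Two ways of splitting the integral of one function over `(-s, x]`: at the point `x - s`, and at
the origin. -/
lemma setLIntegral_advance_add (Pr : Measure Ω) (X : ℕ → Ω → ℝ) (f : ℝ × ℝ → ℝ≥0∞) {s x : ℝ}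
    (hs : 0 ≤ s) (hx : 0 ≤ x) (w : ℝ) :
    (∫⁻ v in Ioo 0 x, advance Pr X s f (v, w)) + ∫⁻ t in Ioo 0 s, advance Pr X t f (x, w) =
      (∫⁻ u in Ioo 0 x, f (u, w)) + ∫⁻ t in Ioo 0 s, ∫⁻ y, f y ∂crossingLaw Pr X t := by
  -- `u` is the position of the walk relative to the level; from below the level it restarts
  let h : ℝ → ℝ≥0∞ := fun u => if 0 ≤ u then f (u, w) else ∫⁻ y, f y ∂crossingLaw Pr X (-u)
  have hh : ∀ t v, advance Pr X t f (v, w) = h (v - t) := by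
    intro t v
    simp only [advance, h, sub_nonneg, neg_sub]
  have h1 : ∫⁻ v in Ioo 0 x, h (v - s) = ∫⁻ u in Ioc (-s) (x - s), h u := by
    rw [setLIntegral_congr Ioo_ae_eq_Ioc, ← lintegral_indicator measurableSet_Ioc,
      ← lintegral_indicator measurableSet_Ioc, ←
      lintegral_sub_right_eq_self ((Ioc (-s) (x - s)).indicator h) s]
    refine lintegral_congr fun v => ?_
    simp only [indicator, mem_Ioc]
    refine if_congr ?_ rfl rfl
    constructor <;> rintro ⟨h1, h2⟩ <;> constructor <;> linarith
  have h2 : ∫⁻ t in Ioo 0 s, h (x - t) = ∫⁻ u in Ioc (x - s) x, h u := by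
    rw [setLIntegral_congr Ioo_ae_eq_Ico, ← lintegral_indicator measurableSet_Ico,
      ← lintegral_indicator measurableSet_Ioc, ←
      lintegral_sub_left_eq_self ((Ioc (x - s) x).indicator h) x]
    refine lintegral_congr fun v => ?_
    simp only [indicator, mem_Ioc, mem_Ico]
    refine if_congr ?_ rfl rfl
    constructor <;> rintro ⟨h1, h2⟩ <;> constructor <;> linarith
  have h3 : ∫⁻ u in Ioo 0 x, f (u, w) = ∫⁻ u in Ioc 0 x, h u := by
    rw [setLIntegral_congr Ioo_ae_eq_Ioc]
    exact setLIntegral_congr_fun measurableSet_Ioc fun u hu => (if_pos hu.1.le).symm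
  have h4 : ∫⁻ t in Ioo 0 s, ∫⁻ y, f y ∂crossingLaw Pr X t = ∫⁻ u in Ioc (-s) 0, h u := by
    rw [← setLIntegral_congr Ioo_ae_eq_Ioc, ← lintegral_indicator measurableSet_Ioo,
      ← lintegral_indicator measurableSet_Ioo, ← lintegral_neg_eq_self]
    refine lintegral_congr fun u => ?_
    by_cases hu : u ∈ Ioo (-s) 0
    · rw [indicator_of_mem hu, indicator_of_mem (by simpa [and_comm, neg_lt] using hu)]
      exact (if_neg (not_le.2 hu.2)).symm
    · rw [indicator_of_notMem hu, indicator_of_notMem (by simpa [and_comm, neg_lt] using hu)]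
  simp only [hh]
  rw [h1, h2, h3, h4, add_comm (∫⁻ u in Ioc 0 x, h u),
    ← lintegral_union measurableSet_Ioc (Ioc_disjoint_Ioc_of_le le_rfl),
    ← lintegral_union measurableSet_Ioc (Ioc_disjoint_Ioc_of_le le_rfl),
    Ioc_union_Ioc_eq_Ioc (by linarith) (by linarith),
    Ioc_union_Ioc_eq_Ioc (by linarith) (by linarith)]

/-- The limit law is invariant. Averaging the identity `setLIntegral_advance_add` over the record
law, the terms with `crossingLaw Pr X t` cancel because the crossing laws are the orbit of the
record law. -/
theorem lintegral_advance_quadrantLaw [IsProbabilityMeasure Pr] (hX : IsIIDWithDensity Pr X p)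
    (hp : IsEvenExpDensity p C η) {q : ℝ → ℝ → ℝ≥0∞} (hq : IsLimitDensity (recordLaw Pr X) q)
    {f : ℝ × ℝ → ℝ≥0∞} (hf : Measurable f) (hf1 : ∀ z, f z ≤ 1) {s : ℝ} (hs : 0 ≤ s) :
    ∫⁻ z, advance Pr X s f z ∂quadrantLaw q = ∫⁻ z, f z ∂quadrantLaw q := by
  have hprob : IsProbabilityMeasure (recordLaw Pr X) := isProbabilityMeasure_crossingLaw hX hp 0
  rw [lintegral_quadrantLaw hX hp hq (measurable_advance hX hf s),
    lintegral_quadrantLaw hX hp hq hf]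
  congr 1
  set G := ∫⁻ t in Ioo 0 s, ∫⁻ y, f y ∂crossingLaw Pr X t with hG
  have hGtop : G ≠ ∞ := by
    have h1 : G ≤ ∫⁻ _ in Ioo (0 : ℝ) s, 1 := by
      refine lintegral_mono fun t => ?_
      have := isProbabilityMeasure_crossingLaw hX hp t
      calc ∫⁻ y, f y ∂crossingLaw Pr X t ≤ ∫⁻ _, 1 ∂crossingLaw Pr X t := lintegral_mono hf1
        _ = 1 := by simp
    refine (h1.trans_lt ?_).ne
    rw [setLIntegral_one, Real.volume_Ioo]
    exact ENNReal.ofReal_lt_top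
  have hswap : ∫⁻ z, (∫⁻ t in Ioo 0 s, advance Pr X t f z) ∂recordLaw Pr X = G := by
    rw [lintegral_lintegral_swap]
    · refine setLIntegral_congr_fun measurableSet_Ioo fun t ht => ?_
      simp only [recordLaw]
      rw [← lintegral_crossingLaw_add hX hf ht.1.le, zero_add]
    · exact ((measurable_advance_uncurry hX hf).comp measurable_swap).aemeasurable
  have hmJ : Measurable fun z : ℝ × ℝ => ∫⁻ t in Ioo 0 s, advance Pr X t f z :=
    Measurable.lintegral_prod_right' (f := fun y : (ℝ × ℝ) × ℝ => advance Pr X y.2 f y.1)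
      ((measurable_advance_uncurry hX hf).comp measurable_swap)
  refine (ENNReal.add_left_inj hGtop).1 ?_
  conv_lhs => rw [← hswap, ← lintegral_add_right _ hmJ]
  have hGint : G = ∫⁻ _, G ∂recordLaw Pr X := by simp
  conv_rhs => rw [hGint, ← lintegral_add_right _ measurable_const]
  refine lintegral_congr_ae ?_
  filter_upwards [ae_crossingLaw_nonneg_pos (Pr := Pr) hX (le_refl (0 : ℝ))] with z hz
  exact setLIntegral_advance_add Pr X f hs hz.1 z.2

end Limit

/-! ### Monotone and exponential convergence -/

section Convergence

variable {Ω : Type*} [MeasurableSpace Ω] {Pr : Measure Ω} {X : ℕ → Ω → ℝ} {p : ℝ → ℝ} {C η : ℝ}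

/-- The transition law of the pair (overshoot, crossing jump) when the level rises by `s`. -/
noncomputable def advanceLaw (Pr : Measure Ω) (X : ℕ → Ω → ℝ) (s : ℝ) (z : ℝ × ℝ) :
    Measure (ℝ × ℝ) :=
  if s ≤ z.1 then Measure.dirac (z.1 - s, z.2) else crossingLaw Pr X (s - z.1)

lemma lintegral_advanceLaw (s : ℝ) (z : ℝ × ℝ) (f : ℝ × ℝ → ℝ≥0∞) :
    ∫⁻ y, f y ∂advanceLaw Pr X s z = advance Pr X s f z := by
  rw [advanceLaw, advance]
  split_ifs with h
  · exact lintegral_dirac _ _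
  · rfl

lemma isProbabilityMeasure_advanceLaw [IsProbabilityMeasure Pr] (hX : IsIIDWithDensity Pr X p)
    (hp : IsEvenExpDensity p C η) (s : ℝ) (z : ℝ × ℝ) :
    IsProbabilityMeasure (advanceLaw Pr X s z) := by
  rw [advanceLaw]
  split_ifs
  · infer_instance
  · exact isProbabilityMeasure_crossingLaw hX hp _

lemma advance_le_one [IsProbabilityMeasure Pr] (hX : IsIIDWithDensity Pr X p)
    (hp : IsEvenExpDensity p C η) (s : ℝ) {f : ℝ × ℝ → ℝ≥0∞} (hf : ∀ z, f z ≤ 1) (z : ℝ × ℝ) :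
    advance Pr X s f z ≤ 1 := by
  have := isProbabilityMeasure_advanceLaw hX hp s z
  rw [← lintegral_advanceLaw]
  calc ∫⁻ y, f y ∂advanceLaw Pr X s z ≤ ∫⁻ _, 1 ∂advanceLaw Pr X s z := lintegral_mono hf
    _ = 1 := by simp

/-- A Markov operator does not increase the `L¹` distance, and the limit law is invariant. -/
lemma antitoneOn_l1Dist [IsProbabilityMeasure Pr] (hX : IsIIDWithDensity Pr X p)
    (hp : IsEvenExpDensity p C η) {q : ℝ → ℝ → ℝ≥0∞} (hq : IsLimitDensity (recordLaw Pr X) q) :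
    AntitoneOn (fun L : ℝ => l1Dist (crossingLaw Pr X L) (quadrantLaw q)) (Ici 0) := by
  intro L _ L' _ hLL'
  have hQ := isProbabilityMeasure_quadrantLaw hX hp hq
  have hL := isProbabilityMeasure_crossingLaw hX hp L
  have hL' := isProbabilityMeasure_crossingLaw hX hp L'
  obtain ⟨S, hS, hle⟩ := exists_l1Dist_le (ρ := crossingLaw Pr X L') (σ := quadrantLaw q)
  refine hle.trans ?_
  let f : ℝ × ℝ → ℝ≥0∞ := S.indicator 1
  have hf : Measurable f := measurable_one.indicator hS
  have hf1 : ∀ z, f z ≤ 1 := fun z => indicator_le_self S 1 z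
  have hs : 0 ≤ L' - L := sub_nonneg.2 hLL'
  have h1 : crossingLaw Pr X L' S = ∫⁻ z, advance Pr X (L' - L) f z ∂crossingLaw Pr X L := by
    rw [← lintegral_crossingLaw_add hX hf hs, add_sub_cancel, lintegral_indicator_one hS]
  have h2 : quadrantLaw q S = ∫⁻ z, advance Pr X (L' - L) f z ∂quadrantLaw q := by
    rw [lintegral_advance_quadrantLaw hX hp hq hf hf1 hs, lintegral_indicator_one hS]
  rw [ENNReal.mul_sub (by simp), tsub_le_iff_left, h1, h2]
  exact two_mul_lintegral_le_add_l1Dist (measurable_advance hX hf _)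
    (advance_le_one hX hp _ hf1)

/-- For a large increment `s` of the level, the transition law satisfies the drift and the
minorization condition of `exists_contraction` with the exponential weight. -/
lemma exists_advance_contraction [IsProbabilityMeasure Pr] (hX : IsIIDWithDensity Pr X p)
    (hp : IsEvenExpDensity p C η) :
    ∃ s α b : ℝ, 0 < s ∧ 0 < α ∧ α < 1 ∧ ∀ (A : ℝ≥0∞) (f : ℝ × ℝ → ℝ≥0∞), Measurable f →
      (∀ x y, f x ≤ f y + A * (2 + ENNReal.ofReal b *
        (overshootWeight (η / 2) x + overshootWeight (η / 2) y))) →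
      ∀ x y, advance Pr X s f x ≤ advance Pr X s f y + ENNReal.ofReal α * A *
        (2 + ENNReal.ofReal b * (overshootWeight (η / 2) x + overshootWeight (η / 2) y)) := by
  have hη := hp.rate_pos
  have hC := hp.one_le
  set K : ℝ := 2 * C with hK
  -- the overshoots of weight at most `16 K` are those up to `r`
  set r : ℝ := Real.log (16 * K) / (η / 2) with hr
  have hr0 : 0 ≤ r := div_nonneg (Real.log_nonneg (by linarith)) (by positivity)
  have hηr : η / 2 * r = Real.log (16 * K) := by rw [hr]; field_simp
  obtain ⟨ν, hν0, hν⟩ := exists_le_crossingLaw hX hp (2 * r + 1)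
  have hνfin : IsFiniteMeasure ν := by
    have := isProbabilityMeasure_crossingLaw hX hp 1
    exact isFiniteMeasure_of_le _ (hν 1 ⟨le_rfl, by linarith⟩)
  have hprob := isProbabilityMeasure_advanceLaw hX hp (r + 1)
  have hdrift : ∀ z, ∫⁻ y, overshootWeight (η / 2) y ∂advanceLaw Pr X (r + 1) z ≤
      overshootWeight (η / 2) z / 2 + ENNReal.ofReal K := by
    intro z
    rw [lintegral_advanceLaw, advance]
    split_ifs with hz
    · refine le_add_right ?_
      rw [overshootWeight, overshootWeight, ← ENNReal.ofReal_ofNat,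
        ← ENNReal.ofReal_div_of_pos two_pos]
      refine ENNReal.ofReal_le_ofReal ?_
      have hz0 : 0 ≤ z.1 := by linarith
      simp only
      rw [abs_of_nonneg (sub_nonneg.2 hz), abs_of_nonneg hz0,
        show η / 2 * (z.1 - (r + 1)) = η / 2 * z.1 - η / 2 * (r + 1) by ring, Real.exp_sub]
      refine div_le_div_of_nonneg_left (Real.exp_pos _).le two_pos ?_
      calc (2 : ℝ) ≤ 16 * K := by linarith
        _ = Real.exp (η / 2 * r) := by rw [hηr, Real.exp_log (by linarith)]
        _ ≤ Real.exp (η / 2 * (r + 1)) := by gcongr; linarith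
    · exact le_add_left (lintegral_overshootWeight_le hX hp (by linarith [not_le.1 hz]))
  have hminor : ∀ z, overshootWeight (η / 2) z ≤ ENNReal.ofReal (16 * K) →
      ν ≤ advanceLaw Pr X (r + 1) z := by
    intro z hz
    have hzr : |z.1| ≤ r := by
      rw [overshootWeight, ENNReal.ofReal_le_ofReal_iff (by linarith),
        ← Real.le_log_iff_exp_le (by linarith), ← hηr] at hz
      exact le_of_mul_le_mul_left hz (by positivity)
    have h1 := abs_le.1 hzr
    rw [advanceLaw, if_neg (by linarith [h1.2])]
    exact hν _ ⟨by linarith [h1.2], by linarith [h1.1]⟩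
  obtain ⟨α, b, hα0, hα1, h⟩ := exists_contraction (measurable_overshootWeight (η / 2))
    (fun _ => ENNReal.ofReal_ne_top) (by positivity) hdrift hν0 hminor
  refine ⟨r + 1, α, b, by linarith, hα0, hα1, fun A f hf hosc x y => ?_⟩
  simpa only [lintegral_advanceLaw] using h A f hf hosc x y

/-- Along multiples of the increment `s` of `exists_advance_contraction` the distance decays
geometrically: iterating the operator on an indicator function shrinks its oscillation, and both the
record law and the limit law integrate the weight. -/
lemma exists_l1Dist_le_exp [IsProbabilityMeasure Pr] (hX : IsIIDWithDensity Pr X p)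
    (hp : IsEvenExpDensity p C η) {q : ℝ → ℝ → ℝ≥0∞} (hq : IsLimitDensity (recordLaw Pr X) q) :
    ∃ C c : ℝ, 0 < C ∧ 0 < c ∧ ∀ L : ℝ, 0 ≤ L →
      l1Dist (crossingLaw Pr X L) (quadrantLaw q) ≤ ENNReal.ofReal (C * Real.exp (-c * L)) := by
  have hQ := isProbabilityMeasure_quadrantLaw hX hp hq
  have hD := isProbabilityMeasure_crossingLaw hX hp 0
  obtain ⟨s, α, b, hs, hα0, hα1, hcon⟩ := exists_advance_contraction hX hp
  set w := overshootWeight (η / 2)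
  set M : ℝ≥0∞ := 2 + ENNReal.ofReal b *
    (∫⁻ z, w z ∂crossingLaw Pr X 0 + ∫⁻ z, w z ∂quadrantLaw q) with hM
  have hMtop : M ≠ ∞ := by
    refine ENNReal.add_ne_top.2 ⟨by simp, ENNReal.mul_ne_top ENNReal.ofReal_ne_top
      (ENNReal.add_ne_top.2 ⟨?_, lintegral_overshootWeight_quadrantLaw_ne_top hX hp hq⟩)⟩
    exact ((lintegral_overshootWeight_le hX hp le_rfl).trans_lt ENNReal.ofReal_lt_top).ne
  have hM0 : 0 < M.toReal := by
    refine ENNReal.toReal_pos ?_ hMtop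
    rw [hM]
    simp
  have hgrid : ∀ n : ℕ, l1Dist (crossingLaw Pr X (n * s)) (quadrantLaw q) ≤
      2 * (ENNReal.ofReal α ^ n * M) := by
    intro n
    have hns := isProbabilityMeasure_crossingLaw hX hp (n * s)
    obtain ⟨S, hS, hle⟩ := exists_l1Dist_le (ρ := crossingLaw Pr X (n * s)) (σ := quadrantLaw q)
    refine hle.trans ?_
    gcongr
    let g : ℕ → ℝ × ℝ → ℝ≥0∞ := fun k => (advance Pr X s)^[k] (S.indicator 1)
    have hgs : ∀ k, g (k + 1) = advance Pr X s (g k) := fun k =>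
      Function.iterate_succ_apply' _ _ _
    have hgm : ∀ k, Measurable (g k) := by
      intro k
      induction k with
      | zero => exact measurable_one.indicator hS
      | succ k ih => rw [hgs]; exact measurable_advance hX ih s
    have hg1 : ∀ k z, g k z ≤ 1 := by
      intro k
      induction k with
      | zero => exact fun z => indicator_le_self S 1 z
      | succ k ih => rw [hgs]; exact advance_le_one hX hp s ih
    have hosc : ∀ k x y, g k x ≤ g k y + ENNReal.ofReal α ^ k *
        (2 + ENNReal.ofReal b * (w x + w y)) := by
      intro k
      induction k with
      | zero =>
        intro x y
        refine (hg1 0 x).trans ?_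
        rw [pow_zero, one_mul]
        refine le_trans ?_ (le_add_left (le_add_right le_rfl))
        norm_num
      | succ k ih =>
        intro x y
        rw [hgs, pow_succ']
        exact hcon _ _ (hgm k) ih x y
    have hcross : ∀ k : ℕ, ∀ m : ℕ, ∫⁻ z, g m z ∂crossingLaw Pr X (k * s) =
        ∫⁻ z, g (m + k) z ∂crossingLaw Pr X 0 := by
      intro k
      induction k with
      | zero => intro m; simp
      | succ k ih =>
        intro m
        rw [show ((k + 1 : ℕ) : ℝ) * s = k * s + s by push_cast; ring,
          lintegral_crossingLaw_add hX (hgm m) hs.le, ← hgs, ih (m + 1),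
          show m + 1 + k = m + (k + 1) by omega]
    have hquad : ∀ k, ∫⁻ z, g k z ∂quadrantLaw q = ∫⁻ z, g 0 z ∂quadrantLaw q := by
      intro k
      induction k with
      | zero => rfl
      | succ k ih =>
        rw [hgs, lintegral_advance_quadrantLaw hX hp hq (hgm k) (hg1 k) hs.le, ih]
    -- with the zero measure as common part, the comparison is the independent coupling
    have h1 := lintegral_le_of_common_part (Measure.zero_le (crossingLaw Pr X 0))
      (Measure.zero_le (quadrantLaw q)) (hgm n) (measurable_overshootWeight (η / 2)) (hosc n)
    rw [Measure.coe_zero, Pi.zero_apply, tsub_zero, mul_one, hquad n, ← zero_add n,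
      ← hcross n 0, zero_add] at h1
    have h2 : ∀ ρ : Measure (ℝ × ℝ), ∫⁻ z, g 0 z ∂ρ = ρ S := fun ρ => lintegral_indicator_one hS
    rw [h2, h2] at h1
    exact tsub_le_iff_left.2 h1
  have hlog : Real.log α < 0 := Real.log_neg hα0 hα1
  refine ⟨2 * M.toReal / α, -Real.log α / s, by positivity, div_pos (by linarith) hs,
    fun L hL => ?_⟩
  have hfloor : (⌊L / s⌋₊ : ℝ) * s ≤ L := by
    rw [← le_div_iff₀ hs]
    exact Nat.floor_le (by positivity)
  refine (antitoneOn_l1Dist hX hp hq (show (0 : ℝ) ≤ _ by positivity) hL hfloor).trans ?_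
  refine (hgrid _).trans ?_
  have hreal : 2 * (ENNReal.ofReal α ^ ⌊L / s⌋₊ * M) =
      ENNReal.ofReal (2 * (α ^ ⌊L / s⌋₊ * M.toReal)) := by
    rw [ENNReal.ofReal_mul two_pos.le, ENNReal.ofReal_mul (by positivity),
      ENNReal.ofReal_toReal hMtop, ENNReal.ofReal_pow hα0.le, ENNReal.ofReal_ofNat]
  rw [hreal]
  refine ENNReal.ofReal_le_ofReal ?_
  have hpow : α ^ ⌊L / s⌋₊ ≤ Real.exp (-(-Real.log α / s) * L) / α := by
    have h1 : L / s - 1 ≤ ⌊L / s⌋₊ := (Nat.sub_one_lt_floor _).le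
    calc α ^ ⌊L / s⌋₊ = Real.exp (Real.log α * ⌊L / s⌋₊) := by
          rw [mul_comm, Real.exp_nat_mul, Real.exp_log hα0]
      _ ≤ Real.exp (Real.log α * (L / s - 1)) :=
          Real.exp_le_exp.2 (mul_le_mul_of_nonpos_left h1 hlog.le)
      _ = Real.exp (-(-Real.log α / s) * L - Real.log α) := by
          congr 1
          ring
      _ = Real.exp (-(-Real.log α / s) * L) / α := by rw [Real.exp_sub, Real.exp_log hα0]
  calc 2 * (α ^ ⌊L / s⌋₊ * M.toReal)
      ≤ 2 * (Real.exp (-(-Real.log α / s) * L) / α * M.toReal) := by gcongr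
    _ = 2 * M.toReal / α * Real.exp (-(-Real.log α / s) * L) := by ring

end Convergence

theorem propositionB1
    (R : ℝ) (hR : 0 < R)
    (κ : unitInterval → ℝ) (hκ : IsCoin κ)
    (P : unitInterval → ℝ → ℝ) (hP : IsKickFamily P)
    (hsymm : SymmetricRates (jumpRate R κ P))
    (htail : ExponentialTails P)
    (hderiv : DerivativeBound P)
    {Ω : Type*} [MeasurableSpace Ω] (Pr : Measure Ω) [IsProbabilityMeasure Pr]
    (X : ℕ → Ω → ℝ) (hX : IsIIDWithDensity Pr X (averagedDensity κ P)) :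
    (0 < meanIncrement (recordLaw Pr X) ∧ meanIncrement (recordLaw Pr X) < ∞) ∧
    ∃ q : ℝ → ℝ → ℝ≥0∞, IsLimitDensity (recordLaw Pr X) q ∧
      Tendsto (fun L : ℝ => l1Dist (crossingLaw Pr X L) (quadrantLaw q)) atTop (𝓝 0) ∧
      (∃ C c : ℝ, 0 < C ∧ 0 < c ∧ ∀ L : ℝ, 0 ≤ L →
        l1Dist (crossingLaw Pr X L) (quadrantLaw q) ≤ ENNReal.ofReal (C * Real.exp (-c * L))) ∧
      AntitoneOn (fun L : ℝ => l1Dist (crossingLaw Pr X L) (quadrantLaw q)) (Ici 0) := by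
  obtain ⟨C₀, η, hp⟩ := isEvenExpDensity_averagedDensity hR hκ hP hsymm htail hderiv
  refine ⟨⟨meanIncrement_pos hX hp, meanIncrement_lt_top hX hp⟩, ?_⟩
  obtain ⟨q, hq⟩ := exists_isLimitDensity hX hp
  obtain ⟨C, c, hC, hc, hexp⟩ := exists_l1Dist_le_exp hX hp hq
  refine ⟨q, hq, ?_, ⟨C, c, hC, hc, hexp⟩, antitoneOn_l1Dist hX hp hq⟩
  have hlim : Tendsto (fun L : ℝ => ENNReal.ofReal (C * Real.exp (-c * L))) atTop (𝓝 0) := by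
    rw [← ENNReal.ofReal_zero]
    refine ENNReal.tendsto_ofReal ?_
    rw [← mul_zero C]
    refine Tendsto.const_mul C (Real.tendsto_exp_atBot.comp ?_)
    exact tendsto_id.const_mul_atTop_of_neg (neg_lt_zero.2 hc)
  exact tendsto_of_tendsto_of_tendsto_of_le_of_le' tendsto_const_nhds hlim
    (Eventually.of_forall fun _ => zero_le)
    ((eventually_ge_atTop 0).mono fun L hL => hexp L hL)
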